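/- Let $p$ be a prime, let $G$ be a finite group, and let $(K,\mathcal O,k)$ be a $p$-modular system such that $k$ is algebraically closed (of characteristic $p$) and $K$ contains a primitive $|G|$-th root of unity; here $\mathcal O$ is a complete discrete valuation ring with residue field $k$ and field of fractions $K$ of characteristic $0$. Let $R$ be $\mathcal O$ or $k$, and write $\overline{\,\cdot\,}$ for the coefficientwise reduction $RH\to kH$ (the identity if $R=k$). Let $\sigma$ be the Frobenius automorphism $\lambda\mapsto\lambda^p$ of $k$, extended coefficientwise to a ring automorphism of $kH$ for every finite group $H$. A block idempotent of $RH$ is a primitive idempotent of $Z(RH)$. For a block idempotent $e$ of $RH$, with $H \leq G$, let $\sigma(e)$ be the unique block idempotent of $RH$ such that $\overline{\sigma(e)}=\sigma(\overline e)$. For a subgroup $H\leq G$, an $RH$-Brauer pair is a pair $(P,e)$ with $P$ a $p$-subgroup of $H$ and $e$ a block idempotent of $RC_H(P)$. These pairs are partially ordered by the reflexive and transitive closure of normal inclusion, where $(Q,f)$ is normally included in $(P,e)$ if $Q\trianglelefteq P$, $f$ is $P$-stable and $\mathrm{Br}_P(\overline f)\,\overline e=\overline e$, with $\mathrm{Br}_P$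 the restriction of coefficients to $C_H(P)$. For a block idempotent $b$ of $RH$, the $b$-Brauer pairs are the pairs containing $(\{1\},b)$. An $RG$-Brauer pair $(P,e)$ is self-centralizing if it is maximal among the $e$-Brauer pairs of the group $PC_G(P)$. Let $N_G(P,e)$ denote the stabilizer of $(P,e)$ in $G$ under conjugation. If $(P,e)$ is self-centralizing and $I=N_G(P,e)$, $\overline I=I/PC_G(P)$, then $k[PC_G(P)]\overline e$ has a unique irreducible module up to isomorphism; let $Y:PC_G(P)\to GL_n(k)$ be a representation affording it. There is a projective representation $X:I\to GL_n(k)$ extending $Y$ with $X(hx)=X(h)X(x)$ and $X(xh)=X(x)X(h)$ for all $h\in PC_G(P)$ and $x\in I$; its factor set $\alpha$, defined by $X(x)X(y)=\alpha(x,y)X(xy)$, induces a $2$-cocycle on $\overline I$, whose class $\kappa_{(P,e)}\in H^2(\overline I,k^\times)$ (trivial action) does not depend on the choices and is called the Külshammer–Puig class at $(P,e)$. Let $(P,e)$ be a self-centralizing $RG$-Brauer pair. Then $(P,\sigma(e))$ is a self-centralizing $RG$-Brauer pair and $N_G(P,\sigma(e))=N_G(P,e)$. Moreover, with $I=N_G(P,e)$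 and $\overline I=I/PC_G(P)$, one has $\kappa_{(P,\sigma(e))}=\kappa_{(P,e)}^{\,p}$ in $H^2(\overline I,k^\times)$. -/

import Mathlib

universe u v

noncomputable section

namespace BlockTheory

/-- A block idempotent of a ring `A`: a primitive idempotent of the centre of `A`, that is, a
nonzero central idempotent that is not a sum of two nonzero orthogonal central idempotents. -/
def IsBlockIdempotent {A : Type*} [Ring A] (b : A) : Prop :=
  b ∈ Subring.center A ∧ IsIdempotentElem b ∧ b ≠ 0 ∧
    ∀ c ∈ Subring.center A, ∀ d ∈ Subring.center A, IsIdempotentElem c → IsIdempotentElem d →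
      c * d = 0 → c + d = b → c = 0 ∨ d = 0

/-- `π : O → k` is the residue map of a `p`-modular system `(K, O, k)`, with `K` the field of
fractions of `O`, such that `K` contains a primitive `n`-th root of unity: `O` is a complete
discrete valuation ring of characteristic zero and `π` is surjective onto the field `k`. (That `k`
is algebraically closed of characteristic `p` is imposed where this is used.) -/
structure IsModularSystem {O : Type v} {k : Type u} [CommRing O] [Field k] (π : O →+* k) (n : ℕ) :
    Prop where
  isDomain : IsDomain O
  isDVR : IsDiscreteValuationRing O
  isComplete : IsAdicComplete (IsLocalRing.maximalIdeal O) O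
  charZero : CharZero O
  surjective : Function.Surjective π
  exists_root : ∃ ζ : FractionRing O, IsPrimitiveRoot ζ n

section GroupAlgebra

variable {G : Type u} [Group G]

/-- The inclusion `R H → R G` of group algebras, for a subgroup `H` of `G`. -/
def incl (R : Type*) [CommRing R] (H : Subgroup G) : MonoidAlgebra R H →+* MonoidAlgebra R G :=
  MonoidAlgebra.mapDomainRingHom R H.subtype

/-- The coefficientwise extension `R G → k G` of a ring homomorphism `R → k`. -/
def reduce {R k : Type*} [CommRing R] [CommRing k] (red : R →+* k) (G : Type*) [Group G] :
    MonoidAlgebra R G →+* MonoidAlgebra k G :=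
  MonoidAlgebra.mapRingHom G red

/-- The truncation `k G → k C_G(P)`; on the `P`-fixed points of `k G` it is the Brauer
homomorphism. -/
def brauerMap {k : Type*} [CommRing k] (P : Subgroup G) (a : MonoidAlgebra k G) :
    MonoidAlgebra k (Subgroup.centralizer (P : Set G)) :=
  MonoidAlgebra.comapDomain (Subgroup.centralizer (P : Set G)).subtype
    (Subgroup.subtype_injective _) a

/-- The element `a` of a group algebra `R H`, `H ≤ G`, is fixed under conjugation by `g : G`. -/
def FixedBy {R : Type*} [CommRing R] {H : Subgroup G} (g : G) (a : MonoidAlgebra R H) : Prop :=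
  MonoidAlgebra.single g 1 * incl R H a * MonoidAlgebra.single g⁻¹ 1 = incl R H a

/-- The subgroup `P C_G(P)` of `G`. -/
def pc (P : Subgroup G) : Subgroup G := P ⊔ Subgroup.centralizer (P : Set G)

theorem centralizer_le_pc (P : Subgroup G) : Subgroup.centralizer (P : Set G) ≤ pc P :=
  le_sup_right

/-- `N_G(P, e)`: the stabilizer of the pair `(P, e)` under conjugation by `G`. -/
def pairStabilizer {R : Type*} [CommRing R] (P : Subgroup G)
    (e : MonoidAlgebra R (Subgroup.centralizer (P : Set G))) : Subgroup G where
  carrier := {g | g ∈ Subgroup.normalizer (P : Set G) ∧ FixedBy g e}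
  one_mem' := ⟨one_mem _, by simp [FixedBy, ← MonoidAlgebra.one_def]⟩
  mul_mem' := by
    rintro a b ⟨ha, ha'⟩ ⟨hb, hb'⟩
    refine ⟨mul_mem ha hb, ?_⟩
    have h1 : (MonoidAlgebra.single (a * b) 1 : MonoidAlgebra R G) =
        MonoidAlgebra.single a 1 * MonoidAlgebra.single b 1 := by
      simp [MonoidAlgebra.single_mul_single]
    have h2 : (MonoidAlgebra.single (a * b)⁻¹ 1 : MonoidAlgebra R G) =
        MonoidAlgebra.single b⁻¹ 1 * MonoidAlgebra.single a⁻¹ 1 := by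
      simp [MonoidAlgebra.single_mul_single]
    unfold FixedBy at *
    rw [h1, h2]
    nth_rewrite 2 [← ha']
    nth_rewrite 2 [← hb']
    simp only [mul_assoc]
  inv_mem' := by
    rintro a ⟨ha, ha'⟩
    refine ⟨inv_mem ha, ?_⟩
    have h1 : (MonoidAlgebra.single a⁻¹ 1 * MonoidAlgebra.single a 1 : MonoidAlgebra R G) = 1 := by
      simp [MonoidAlgebra.single_mul_single, MonoidAlgebra.one_def]
    unfold FixedBy at *
    rw [inv_inv]
    nth_rewrite 1 [← ha']
    calc _ = (MonoidAlgebra.single a⁻¹ 1 * MonoidAlgebra.single a 1) *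
          incl R (Subgroup.centralizer (P : Set G)) e *
          (MonoidAlgebra.single a⁻¹ 1 * MonoidAlgebra.single a 1) := by simp only [mul_assoc]
      _ = _ := by rw [h1, one_mul, mul_one]

theorem pairStabilizer_le_normalizer {R : Type*} [CommRing R] (P : Subgroup G)
    (e : MonoidAlgebra R (Subgroup.centralizer (P : Set G))) :
    pairStabilizer P e ≤ Subgroup.normalizer (P : Set G) := fun _ h => h.1

/-- `P C_G(P)` is normal in every subgroup of `N_G(P)`. -/
theorem pc_subgroupOf_normal (P I : Subgroup G) (hI : I ≤ Subgroup.normalizer (P : Set G)) :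
    ((pc P).subgroupOf I).Normal := by
  apply Subgroup.normal_subgroupOf_of_le_normalizer
  intro g hg
  have hg := hI hg
  have hC : ∀ g ∈ Subgroup.normalizer (P : Set G),
      pc P ≤ (pc P).comap (MulAut.conj g).toMonoidHom := by
    intro g hg
    refine sup_le (fun x hx => ?_) (fun x hx => ?_)
    · exact (le_sup_left : P ≤ pc P) ((Subgroup.mem_normalizer_iff.1 hg x).1 hx)
    · refine centralizer_le_pc P ?_
      change g * x * g⁻¹ ∈ _
      rw [Subgroup.mem_centralizer_iff] at hx ⊢
      intro y hy
      have := hx (g⁻¹ * y * g) (by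
        have h := Subgroup.mem_normalizer_iff.1 (inv_mem hg) y
        simpa using h.1 hy)
      calc y * (g * x * g⁻¹) = g * ((g⁻¹ * y * g) * x) * g⁻¹ := by group
        _ = g * (x * (g⁻¹ * y * g)) * g⁻¹ := by rw [this]
        _ = g * x * g⁻¹ * y := by group
  rw [Subgroup.mem_normalizer_iff]
  intro x
  refine ⟨fun hx => hC g hg hx, fun hx => ?_⟩
  have := hC g⁻¹ (inv_mem hg) hx
  simpa [mul_assoc] using this

instance {R : Type*} [CommRing R] (P : Subgroup G)
    (e : MonoidAlgebra R (Subgroup.centralizer (P : Set G))) :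
    ((pc P).subgroupOf (pairStabilizer P e)).Normal :=
  pc_subgroupOf_normal P _ (pairStabilizer_le_normalizer P e)

/-- `(P, e)` is an `R G`-Brauer pair: `P` is a `p`-subgroup of `G` and `e` is a block idempotent
of `R C_G(P)`. -/
def IsBrauerPair (p : ℕ) {R : Type*} [CommRing R] (P : Subgroup G)
    (e : MonoidAlgebra R (Subgroup.centralizer (P : Set G))) : Prop :=
  IsPGroup p P ∧ IsBlockIdempotent e

end GroupAlgebra

/-- The type of `R G`-Brauer pairs. -/
structure BrauerPair (p : ℕ) (R : Type v) [CommRing R] (G : Type u) [Group G] where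
  P : Subgroup G
  e : MonoidAlgebra R (Subgroup.centralizer (P : Set G))
  isBrauerPair : IsBrauerPair p P e

namespace BrauerPair

variable {p : ℕ} {R : Type v} {k : Type u} {G : Type u} [CommRing R] [Field k] [Group G]

/-- Normal inclusion `(Q, f) ⊴ (P, e)` of Brauer pairs: `Q` is a normal subgroup of `P`, `f` is
`P`-stable, and `Br_P(f) e = e` in `k C_G(P)` (after reduction of the coefficients to `k`). -/
def NormalLE (red : R →+* k) (X Y : BrauerPair p R G) : Prop :=
  X.P ≤ Y.P ∧ Y.P ≤ Subgroup.normalizer (X.P : Set G) ∧ (∀ g ∈ Y.P, FixedBy g X.e) ∧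
    brauerMap Y.P (incl k _ (reduce red _ X.e)) * reduce red _ Y.e = reduce red _ Y.e

/-- Inclusion of Brauer pairs (Alperin-Broué): the reflexive and transitive closure of normal
inclusion. -/
def Incl (red : R →+* k) (X Y : BrauerPair p R G) : Prop :=
  Relation.ReflTransGen (NormalLE red) X Y

/-- The `b`-Brauer pairs, for a block idempotent `b` of `R G`: the Brauer pairs that contain
`({1}, b)`. -/
def blockPairs (red : R →+* k) (b : MonoidAlgebra R G) : Set (BrauerPair p R G) :=
  {X | ∃ Y : BrauerPair p R G, Y.P = ⊥ ∧ incl R _ Y.e = b ∧ Incl red Y X}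

end BrauerPair

section SelfCentralizing

variable {R : Type v} {k : Type u} {G : Type u} [CommRing R] [Field k] [Group G]

/-- The Brauer pair `(P, e)` of `G` is self-centralizing: it is an `e`-Brauer pair of the group
`P C_G(P)` and is maximal among these. The pair `X` below is `(P, e)` viewed as a Brauer pair of
the group `P C_G(P)`; it is determined by the two equations that are imposed on it. -/
def IsSelfCentralizing (p : ℕ) (red : R →+* k) (P : Subgroup G)
    (e : MonoidAlgebra R (Subgroup.centralizer (P : Set G))) : Prop :=
  IsBrauerPair p P e ∧
  ∃ X : BrauerPair p R (pc P),
    X.P = P.subgroupOf (pc P) ∧ incl R _ (incl R _ X.e) = incl R _ e ∧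
    X ∈ BrauerPair.blockPairs red
      (MonoidAlgebra.mapDomainRingHom R (Subgroup.inclusion (centralizer_le_pc P)) e) ∧
    ∀ Y ∈ BrauerPair.blockPairs red
      (MonoidAlgebra.mapDomainRingHom R (Subgroup.inclusion (centralizer_le_pc P)) e),
      BrauerPair.Incl red X Y → Y = X

/-- `e'` is a Frobenius conjugate `σ(e)` of the block idempotent `e`: it is a block idempotent
whose reduction modulo the maximal ideal is obtained from that of `e` by raising the coefficients
to the `p`-th power. -/
def IsFrobeniusConjugate (p : ℕ) [Fact p.Prime] [CharP k p] (red : R →+* k)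
    {H : Type*} [Group H] (e e' : MonoidAlgebra R H) : Prop :=
  IsBlockIdempotent e' ∧ reduce red H e' = reduce (frobenius k p) H (reduce red H e)

/-- The group `kˣ` with trivial action of `Q`, written additively. (Coefficients are taken in
a copy of `ℤ` in the universe of `k`.) -/
abbrev unitsRep (Q k : Type u) [Group Q] [Field k] : Rep (ULift.{u} ℤ) Q :=
  Rep.trivial (ULift.{u} ℤ) Q (Additive kˣ)

/-- The cohomology group `H²(Q, kˣ)` for the trivial action, written additively. -/
abbrev H2Units (Q k : Type u) [Group Q] [Field k] : Type u :=
  groupCohomology.H2 (unitsRep Q k)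

/-- `κ` is the Külshammer-Puig class at `(P, e)`, where `I = N_G(P, e)`, in
`H²(I / P C_G(P), kˣ)`. Here `Y` is an irreducible representation of `P C_G(P)` over `k` in the
block of (the reduction of) `e`, `X` is a projective representation of `I` that extends `Y` and
satisfies `X(hx) = X(h)X(x)` and `X(xh) = X(x)X(h)` for `h ∈ P C_G(P)` and `x ∈ I`, and
`κ` is the class of the 2-cocycle `α` on `I / P C_G(P)` induced by the factor set of `X`. -/
def IsKuelshammerPuigClass (red : R →+* k) (P : Subgroup G)
    (e : MonoidAlgebra R (Subgroup.centralizer (P : Set G)))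
    (I : Subgroup G) [((pc P).subgroupOf I).Normal]
    (κ : H2Units (I ⧸ (pc P).subgroupOf I) k) : Prop :=
  ∃ (n : ℕ) (Y : Representation k (pc P) (Fin n → k))
    (X : I → LinearMap.GeneralLinearGroup k (Fin n → k))
    (α : groupCohomology.cocycles₂ (unitsRep (I ⧸ (pc P).subgroupOf I) k)),
    Y.IsIrreducible ∧
    Y.asAlgebraHom (MonoidAlgebra.mapDomainRingHom k (Subgroup.inclusion (centralizer_le_pc P))
      (reduce red _ e)) = 1 ∧
    (∀ (h : I) (hh : (h : G) ∈ pc P), (X h : Module.End k (Fin n → k)) = Y ⟨h, hh⟩) ∧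
    (∀ h x : I, (h : G) ∈ pc P → X (h * x) = X h * X x ∧ X (x * h) = X x * X h) ∧
    (∀ x y : I, (X x * X y : Module.End k (Fin n → k)) =
      ((Additive.toMul (α ((x : I ⧸ (pc P).subgroupOf I), (y : I ⧸ (pc P).subgroupOf I)) :
        Additive kˣ) : kˣ) : k) • (X (x * y) : Module.End k (Fin n → k))) ∧
    groupCohomology.H2π (unitsRep (I ⧸ (pc P).subgroupOf I) k) α = κ

end SelfCentralizing

end BlockTheory

end

open BlockTheory

/-! Frobenius acts on coefficients only, so it commutes with conjugation by `G`, with inclusions of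
group algebras and with the truncation `brauerMap`. Over `k` it thus preserves everything that
enters into Brauer pairs and their inclusion. Both choices of `R` are treated at once: `red` is
surjective and `R` is complete with respect to its kernel (`IsCompleteReduction`). Central
idempotents then lift (`IsCompleteReduction.exists_lift`), and commuting idempotents with equal
reductions coincide (`IsCompleteReduction.eq_of_commute`). Hence `BrauerPair.twist` is an
inclusion-preserving bijection on Brauer pairs, inverted by the twist with the inverse automorphism,
and it carries along stabilizers and self-centralizing pairs.

Let `Y`, `X`, `α` realize the class at `(P, e)`. Raising matrix entries to the `p`-th power gives an
irreducible representation in the block of `σ(e)`, a projective extension of it, and the factor set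
`α ^ p`, written additively `p • α` (`IsKuelshammerPuigClass.frobenius`).

It remains to see that the class exists and is unique. By Schur's lemma this reduces to the
uniqueness of the irreducible module of the block `b` of `k[P C_G(P)]` given by `e`
(`nonempty_equiv_of_isBlockIdempotent`). Maximality of the pair forces `Br_Q(b) = 0` for every
`p`-subgroup `Q > P`, which makes `b` a relative trace from `P`; moreover `P` acts trivially on
irreducible modules. If two irreducibles of `b` were not isomorphic, the density theorem would give
an element acting as `1` on one and `0` on the other. Tracing it up from `P` yields a central
element with the same property, but a central element cannot act by different scalars within one
block (`eq_of_isBlockIdempotent`). -/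

namespace BlockTheory

/-! ### Group algebra elements described by their coefficients -/

section Coefficients

variable {R : Type*} [CommRing R] {G H : Type*} [Group G] [Group H]

theorem mem_center_iff_coeff {a : MonoidAlgebra R G} :
    a ∈ Subring.center (MonoidAlgebra R G) ↔ ∀ g h, a.coeff (g * h * g⁻¹) = a.coeff h := by
  rw [Subring.mem_center_iff]
  constructor
  · intro ha g h
    have := congrArg (fun x => x.coeff (g * h)) (ha (MonoidAlgebra.single g 1))
    simpa using this.symm
  · intro ha x
    induction x using MonoidAlgebra.induction_linear with
    | zero => simp
    | add x y hx hy => rw [add_mul, mul_add, hx, hy]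
    | single g r =>
      ext h
      have := ha g (g⁻¹ * h)
      simp only [mul_inv_cancel_left] at this
      simp [this, mul_comm]

theorem coeff_mapDomainRingHom {f : H →* G} (hf : Function.Injective f) (a : MonoidAlgebra R H)
    (h : H) : (MonoidAlgebra.mapDomainRingHom R f a).coeff (f h) = a.coeff h := by
  simp [Finsupp.mapDomain_apply hf]

theorem coeff_mapDomainRingHom_of_notMem {f : H →* G} (a : MonoidAlgebra R H) {g : G}
    (hg : g ∉ Set.range f) : (MonoidAlgebra.mapDomainRingHom R f a).coeff g = 0 := by
  simp [Finsupp.mapDomain_of_notMem_range _ _ hg]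

theorem mapDomainRingHom_injective {f : H →* G} (hf : Function.Injective f) :
    Function.Injective (MonoidAlgebra.mapDomainRingHom R f) := by
  intro a b hab
  ext h
  rw [← coeff_mapDomainRingHom hf, hab, coeff_mapDomainRingHom hf]

theorem incl_injective (K : Subgroup G) : Function.Injective (incl R K) :=
  mapDomainRingHom_injective K.subtype_injective

theorem coeff_incl {K : Subgroup G} (a : MonoidAlgebra R K) (h : K) :
    (incl R K a).coeff h = a.coeff h :=
  coeff_mapDomainRingHom K.subtype_injective a h

theorem coeff_incl_of_notMem {K : Subgroup G} (a : MonoidAlgebra R K) {g : G} (hg : g ∉ K) :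
    (incl R K a).coeff g = 0 :=
  coeff_mapDomainRingHom_of_notMem a (by simpa using hg)

theorem exists_incl_eq {K : Subgroup G} (x : MonoidAlgebra R G)
    (hx : ∀ g ∉ K, x.coeff g = 0) : ∃ a, incl R K a = x := by
  refine ⟨MonoidAlgebra.comapDomain K.subtype K.subtype_injective x, ?_⟩
  ext g
  by_cases hg : g ∈ K
  · have := coeff_incl (MonoidAlgebra.comapDomain K.subtype K.subtype_injective x) ⟨g, hg⟩
    simpa using this
  · rw [coeff_incl_of_notMem _ hg, hx g hg]

theorem fixedBy_iff_coeff {K : Subgroup G} {g : G} {a : MonoidAlgebra R K} :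
    FixedBy g a ↔ ∀ h, (incl R K a).coeff (g⁻¹ * h * g) = (incl R K a).coeff h := by
  unfold FixedBy
  rw [MonoidAlgebra.ext_iff, Finsupp.ext_iff]
  simp [mul_assoc]

theorem coeff_brauerMap {P : Subgroup G} (a : MonoidAlgebra R G)
    (h : Subgroup.centralizer (P : Set G)) : (brauerMap P a).coeff h = a.coeff h := by
  simp [brauerMap]

theorem coeff_reduce {k : Type*} [CommRing k] (red : R →+* k) (a : MonoidAlgebra R G) (g : G) :
    (reduce red G a).coeff g = red (a.coeff g) :=
  MonoidAlgebra.coeff_mapRingHom _ _ _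

theorem reduce_mapDomainRingHom {k : Type*} [CommRing k] (red : R →+* k) (f : H →* G)
    (a : MonoidAlgebra R H) :
    reduce red G (MonoidAlgebra.mapDomainRingHom R f a) =
      MonoidAlgebra.mapDomainRingHom k f (reduce red H a) :=
  RingHom.congr_fun (MonoidAlgebra.mapRingHom_comp_mapDomainRingHom red f) a

theorem reduce_incl {k : Type*} [CommRing k] (red : R →+* k) (K : Subgroup G)
    (a : MonoidAlgebra R K) : reduce red G (incl R K a) = incl k K (reduce red K a) :=
  reduce_mapDomainRingHom red K.subtype a

theorem reduce_mem_center {k : Type*} [CommRing k] (red : R →+* k) {a : MonoidAlgebra R G}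
    (ha : a ∈ Subring.center (MonoidAlgebra R G)) :
    reduce red G a ∈ Subring.center (MonoidAlgebra k G) := by
  rw [mem_center_iff_coeff] at ha ⊢
  simp [coeff_reduce, ha]

theorem exists_center_reduce_eq [Finite G] {k : Type*} [CommRing k] {red : R →+* k}
    (hred : Function.Surjective red) {z : MonoidAlgebra k G}
    (hz : z ∈ Subring.center (MonoidAlgebra k G)) :
    ∃ a ∈ Subring.center (MonoidAlgebra R G), reduce red G a = z := by
  refine ⟨.ofCoeff (Finsupp.equivFunOnFinite.symm
    fun g => Function.surjInv hred (z.coeff g)), ?_, ?_⟩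
  · rw [mem_center_iff_coeff] at hz ⊢
    simp [hz]
  · ext g
    simp [coeff_reduce, Function.surjInv_eq hred]

end Coefficients

/-! ### Idempotents over an adically complete ring -/

section Lifting

variable {R : Type*} [CommRing R] {G : Type*} [Group G] {I J : Ideal R}

/-- All coefficients of `x` lie in the ideal `I`. -/
def CoeffMem (I : Ideal R) (x : MonoidAlgebra R G) : Prop := ∀ g, x.coeff g ∈ I

theorem CoeffMem.mul {x y : MonoidAlgebra R G} (hx : CoeffMem I x) (hy : CoeffMem J y) :
    CoeffMem (I * J) (x * y) := by
  classical
  intro g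
  rw [MonoidAlgebra.coeff_mul]
  refine Ideal.sum_mem _ fun a _ => Ideal.sum_mem _ fun b _ => ?_
  dsimp only
  split_ifs
  · exact Ideal.mul_mem_mul (hx a) (hy b)
  · exact zero_mem _

theorem CoeffMem.mul_right {x : MonoidAlgebra R G} (hx : CoeffMem I x) (y : MonoidAlgebra R G) :
    CoeffMem I (x * y) := by
  have := hx.mul (J := ⊤) (y := y) fun _ => trivial
  rwa [Ideal.mul_top] at this

theorem CoeffMem.add {x y : MonoidAlgebra R G} (hx : CoeffMem I x) (hy : CoeffMem I y) :
    CoeffMem I (x + y) := fun g => I.add_mem (hx g) (hy g)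

theorem CoeffMem.sub {x y : MonoidAlgebra R G} (hx : CoeffMem I x) (hy : CoeffMem I y) :
    CoeffMem I (x - y) := fun g => I.sub_mem (hx g) (hy g)

omit [Group G] in
theorem CoeffMem.mono {x : MonoidAlgebra R G} (hx : CoeffMem I x) (h : I ≤ J) :
    CoeffMem J x := fun g => h (hx g)

theorem eq_zero_of_forall_coeffMem_pow [IsHausdorff I R] {x : MonoidAlgebra R G}
    (hx : ∀ n, CoeffMem (I ^ n) x) : x = 0 := by
  ext g
  refine IsHausdorff.haus ‹_› _ fun n => ?_
  rw [SModEq.zero]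
  simpa using hx n g

/-- Since `x` equals all its positive powers, its coefficients lie in every power of `I`. -/
theorem IsIdempotentElem.eq_zero_of_coeffMem [IsHausdorff I R] {x : MonoidAlgebra R G}
    (hx : IsIdempotentElem x) (h : CoeffMem I x) : x = 0 := by
  have key : ∀ n, CoeffMem (I ^ n) x := by
    intro n
    induction n with
    | zero => intro g; simp
    | succ n ih => rw [pow_succ, ← hx.eq]; exact ih.mul h
  exact eq_zero_of_forall_coeffMem_pow key

/-- Newton iteration: the idempotency defect of the iterates tends to zero, the iterates stay
central, and they converge coefficientwise. -/
theorem exists_central_idempotent_of_coeffMem [IsAdicComplete I R] [Finite G]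
    {a : MonoidAlgebra R G} (ha : a ∈ Subring.center (MonoidAlgebra R G))
    (h : CoeffMem I (a * a - a)) :
    ∃ b ∈ Subring.center (MonoidAlgebra R G), IsIdempotentElem b ∧ CoeffMem I (b - a) := by
  -- The polynomial `3x² - 2x³` fixes `0` and `1` with zero derivative there, so it squares the
  -- defect `x² - x` up to a factor (`hF2`).
  let F : MonoidAlgebra R G → MonoidAlgebra R G := fun x => x * x * (3 - 2 * x)
  let s : ℕ → MonoidAlgebra R G := fun n => F^[n] a
  have hs : ∀ n, s (n + 1) = F (s n) := fun n => Function.iterate_succ_apply' F n a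
  have hc : ∀ n, s n ∈ Subring.center (MonoidAlgebra R G) := by
    intro n
    induction n with
    | zero => exact ha
    | succ n ih =>
      rw [hs]
      exact mul_mem (mul_mem ih ih) (sub_mem (ofNat_mem _ 3) (mul_mem (ofNat_mem _ 2) ih))
  have hF1 : ∀ x, F x - x = (x * x - x) * (1 - 2 * x) := by
    intro x; simp only [F]; noncomm_ring
  have hF2 : ∀ x, F x * F x - F x = (x * x - x) * (x * x - x) * (4 * (x * x - x) - 3) := by
    intro x; simp only [F]; noncomm_ring
  have hI : ∀ n, CoeffMem (I ^ (n + 1)) (s n * s n - s n) := by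
    intro n
    induction n with
    | zero => simpa using! h
    | succ n ih =>
      rw [hs, hF2]
      refine ((ih.mul ih).mul_right _).mono ?_
      rw [← pow_add]
      exact Ideal.pow_le_pow_right (by omega)
  have hd : ∀ n, CoeffMem (I ^ (n + 1)) (s (n + 1) - s n) := by
    intro n
    rw [hs, hF1]
    exact (hI n).mul_right _
  have hd' : ∀ n m, n ≤ m → CoeffMem (I ^ (n + 1)) (s m - s n) := by
    intro n m hnm
    induction m, hnm using Nat.le_induction with
    | base => intro g; simp
    | succ m hm ih =>
      have := ((hd m).mono (Ideal.pow_le_pow_right (by omega : n + 1 ≤ m + 1))).add ih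
      simpa using this
  have hL : ∀ g, ∃ L : R, ∀ n, (s n).coeff g - L ∈ I ^ n := by
    intro g
    obtain ⟨L, hL⟩ := IsPrecomplete.prec (I := I) (M := R) inferInstance
      (f := fun n => (s n).coeff g) (by
        intro m n hmn
        rw [SModEq.sub_mem]
        have := (hd' m n hmn).mono (Ideal.pow_le_pow_right (Nat.le_succ m)) g
        rw [← neg_mem_iff]
        simpa using this)
    refine ⟨L, fun n => ?_⟩
    have := hL n
    rw [SModEq.sub_mem] at this
    simpa using this
  choose L hL using hL
  -- Finiteness of `G` makes the family of limits an element of the group algebra.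
  let b : MonoidAlgebra R G := .ofCoeff (Finsupp.equivFunOnFinite.symm L)
  have hb : ∀ n, CoeffMem (I ^ n) (s n - b) := fun n g => by simpa [b] using hL g n
  refine ⟨b, ?_, ?_, ?_⟩
  · rw [mem_center_iff_coeff]
    intro g h
    rw [← sub_eq_zero]
    refine IsHausdorff.haus (I := I) (M := R) inferInstance _ fun n => ?_
    rw [SModEq.zero, smul_eq_mul, Ideal.mul_top]
    have h1 := hb n (g * h * g⁻¹)
    have h2 := hb n h
    have h3 := (mem_center_iff_coeff.1 (hc n)) g h
    have := sub_mem h2 h1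
    simpa [h3] using this
  · rw [IsIdempotentElem, ← sub_eq_zero]
    refine eq_zero_of_forall_coeffMem_pow (I := I) fun n => ?_
    have h1 := ((hI n).mono (Ideal.pow_le_pow_right (Nat.le_succ n)))
    have h2 : CoeffMem (I ^ n) (s n * (s n - b)) := by
      have := CoeffMem.mul (I := ⊤) (x := s n) (fun _ => trivial) (hb n)
      rwa [Ideal.top_mul] at this
    have h3 := (hb n).mul_right b
    have := ((h1.sub h2).sub h3).add (hb n)
    convert this using 1
    noncomm_ring
  · have h1 := (hb 1).mono (Ideal.pow_le_self one_ne_zero)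
    have h2 := (hd 0).mono (Ideal.pow_le_self (n := 0 + 1) (by simp))
    have := h2.sub h1
    convert this using 1
    simp [s]
end Lifting

/-! ### Block idempotents under reduction and under automorphisms of the residue field -/

theorem map_mem_center {A B : Type*} [Ring A] [Ring B] (f : A ≃+* B) {a : A}
    (ha : a ∈ Subring.center A) : f a ∈ Subring.center B := by
  rw [Subring.mem_center_iff] at ha ⊢
  intro x
  obtain ⟨y, rfl⟩ := f.surjective x
  rw [← map_mul, ha, map_mul]

theorem IsBlockIdempotent.map {A B : Type*} [Ring A] [Ring B] (f : A ≃+* B) {b : A}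
    (hb : IsBlockIdempotent b) : IsBlockIdempotent (f b) := by
  obtain ⟨hc, hi, h0, hp⟩ := hb
  refine ⟨map_mem_center f hc, hi.map f, by simpa using h0,
    fun c hc d hd hci hdi hcd hsum => ?_⟩
  have := hp _ (map_mem_center f.symm hc) _ (map_mem_center f.symm hd) (hci.map f.symm)
    (hdi.map f.symm) (by rw [← map_mul, hcd, map_zero])
    (by rw [← map_add, hsum, f.symm_apply_apply])
  simpa using this

/-- The ring homomorphism `red` is surjective, and its source is complete with respect to
its kernel. -/
structure IsCompleteReduction {R k : Type*} [CommRing R] [CommRing k] (red : R →+* k) : Prop where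
  surjective : Function.Surjective red
  complete : IsAdicComplete (RingHom.ker red) R

theorem isCompleteReduction_of_bijective {R k : Type*} [CommRing R] [CommRing k] {red : R →+* k}
    (h : Function.Bijective red) : IsCompleteReduction red := by
  refine ⟨h.2, ?_⟩
  rw [(RingHom.injective_iff_ker_eq_bot red).1 h.1]
  infer_instance

theorem IsModularSystem.isCompleteReduction {R : Type v} {k : Type u} [CommRing R] [Field k]
    {red : R →+* k} {n : ℕ} (h : IsModularSystem red n) : IsCompleteReduction red := by
  have := h.isDomain
  have := h.isDVR
  refine ⟨h.surjective, ?_⟩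
  have hm : (RingHom.ker red).IsMaximal := RingHom.ker_isMaximal_of_surjective red h.surjective
  rw [IsLocalRing.eq_maximalIdeal hm]
  exact h.isComplete

section Lifting

variable {R k : Type*} [CommRing R] [CommRing k] {red : R →+* k} {G : Type*} [Group G]

theorem coeffMem_ker_iff {x : MonoidAlgebra R G} :
    CoeffMem (RingHom.ker red) x ↔ reduce red G x = 0 := by
  rw [MonoidAlgebra.ext_iff, Finsupp.ext_iff]
  simp [CoeffMem, coeff_reduce, RingHom.mem_ker]

theorem IsCompleteReduction.eq_zero (hred : IsCompleteReduction red) {x : MonoidAlgebra R G}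
    (hx : IsIdempotentElem x) (h : reduce red G x = 0) : x = 0 :=
  have := hred.complete
  IsIdempotentElem.eq_zero_of_coeffMem hx (coeffMem_ker_iff.2 h)

/-- For commuting idempotents, `x * (1 - y)` is an idempotent with reduction zero, hence zero;
symmetrically with `x` and `y` exchanged. Without commutation this can fail, for instance for
conjugate idempotents. -/
theorem IsCompleteReduction.eq_of_commute (hred : IsCompleteReduction red)
    {x y : MonoidAlgebra R G} (hx : IsIdempotentElem x) (hy : IsIdempotentElem y)
    (hxy : Commute x y) (h : reduce red G x = reduce red G y) : x = y := by
  have key : ∀ {x y : MonoidAlgebra R G}, IsIdempotentElem x → IsIdempotentElem y →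
      Commute x y → reduce red G x = reduce red G y → x = x * y := by
    intro x y hx hy hxy h
    have h1 : IsIdempotentElem (x * (1 - y)) :=
      hx.mul_of_commute ((Commute.one_right x).sub_right hxy) hy.one_sub
    have h2 := hred.eq_zero h1 (by
      rw [map_mul, map_sub, map_one, h, mul_sub, mul_one, ← map_mul, hy.eq, sub_self])
    rwa [mul_sub, mul_one, sub_eq_zero] at h2
  rw [key hx hy hxy h, hxy.eq, ← key hy hx hxy.symm h.symm]

theorem IsCompleteReduction.exists_lift [Finite G] (hred : IsCompleteReduction red)
    {z : MonoidAlgebra k G} (hz : z ∈ Subring.center (MonoidAlgebra k G))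
    (hz' : IsIdempotentElem z) :
    ∃ b ∈ Subring.center (MonoidAlgebra R G), IsIdempotentElem b ∧ reduce red G b = z := by
  have := hred.complete
  obtain ⟨a, ha, rfl⟩ := exists_center_reduce_eq hred.surjective hz
  obtain ⟨b, hb, hb', h⟩ := exists_central_idempotent_of_coeffMem (I := RingHom.ker red) ha (by
    rw [coeffMem_ker_iff, map_sub, map_mul, hz'.eq, sub_self])
  refine ⟨b, hb, hb', ?_⟩
  rwa [coeffMem_ker_iff, map_sub, sub_eq_zero] at h

theorem commute_of_mem_center {A : Type*} [Ring A] {a : A} (ha : a ∈ Subring.center A) (b : A) :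
    Commute a b := (Subring.mem_center_iff.1 ha b).symm

theorem IsCompleteReduction.isBlockIdempotent_reduce_iff [Finite G]
    (hred : IsCompleteReduction red)
    {b : MonoidAlgebra R G} (hb : b ∈ Subring.center (MonoidAlgebra R G))
    (hb' : IsIdempotentElem b) :
    IsBlockIdempotent (reduce red G b) ↔ IsBlockIdempotent b := by
  constructor
  · rintro ⟨-, -, h0, hp⟩
    refine ⟨hb, hb', fun h => h0 (by rw [h, map_zero]), fun c hc d hd hci hdi hcd hsum => ?_⟩
    refine (hp _ (reduce_mem_center red hc) _ (reduce_mem_center red hd) (hci.map _) (hdi.map _)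
      (by rw [← map_mul, hcd, map_zero]) (by rw [← map_add, hsum])).imp
      (hred.eq_zero hci) (hred.eq_zero hdi)
  · rintro ⟨-, -, h0, hp⟩
    refine ⟨reduce_mem_center red hb, hb'.map _, fun h => h0 (hred.eq_zero hb' h),
      fun c hc d hd hci hdi hcd hsum => ?_⟩
    obtain ⟨c', hc', hci', rfl⟩ := hred.exists_lift hc hci
    obtain ⟨d', hd', hdi', rfl⟩ := hred.exists_lift hd hdi
    have hcd' : c' * d' = 0 := hred.eq_zero
      (hci'.mul_of_commute (commute_of_mem_center hc' d') hdi') (by rw [map_mul, hcd])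
    have hdc' : d' * c' = 0 := by rw [(commute_of_mem_center hd' c').eq, hcd']
    have hs : IsIdempotentElem (c' + d') := by
      rw [IsIdempotentElem, mul_add, add_mul, add_mul, hci'.eq, hdi'.eq, hcd', hdc']
      simp
    have hsum' : c' + d' = b := hred.eq_of_commute hs hb'
      (commute_of_mem_center hb _).symm (by rw [map_add, hsum])
    exact (hp c' hc' d' hd' hci' hdi' hcd' hsum').imp (fun h => by rw [h, map_zero])
      (fun h => by rw [h, map_zero])

theorem reduce_ringEquiv_eq (τ : k ≃+* k) (a : MonoidAlgebra k G) :
    reduce (τ : k →+* k) G a = MonoidAlgebra.mapRingEquiv G τ a := by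
  ext g
  simp [coeff_reduce]

/-- This makes `σ(e)` well defined: apply the automorphism in `k G`, then lift the resulting block.
-/
theorem IsCompleteReduction.existsUnique_twist [Finite G] (hred : IsCompleteReduction red)
    (τ : k ≃+* k) {e : MonoidAlgebra R G} (he : IsBlockIdempotent e) :
    ∃! e' : MonoidAlgebra R G, IsBlockIdempotent e' ∧
      reduce red G e' = reduce (τ : k →+* k) G (reduce red G e) := by
  have h1 : IsBlockIdempotent (reduce red G e) :=
    (hred.isBlockIdempotent_reduce_iff he.1 he.2.1).2 he
  have h2 : IsBlockIdempotent (reduce (τ : k →+* k) G (reduce red G e)) := by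
    rw [reduce_ringEquiv_eq]
    exact h1.map _
  obtain ⟨b, hb, hb', h⟩ := hred.exists_lift h2.1 h2.2.1
  refine ⟨b, ⟨(hred.isBlockIdempotent_reduce_iff hb hb').1 (h ▸ h2), h⟩, fun c hc => ?_⟩
  exact hred.eq_of_commute hc.1.2.1 hb' (commute_of_mem_center hb c).symm (hc.2.trans h.symm)

theorem reduce_reduce_of_leftInverse {τ τ' : k ≃+* k} (h : ∀ x, τ' (τ x) = x)
    (a : MonoidAlgebra k G) : reduce (τ' : k →+* k) G (reduce (τ : k →+* k) G a) = a := by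
  ext g
  simp [coeff_reduce, h]

theorem reduce_symm_reduce (τ : k ≃+* k) {e e' : MonoidAlgebra R G}
    (h : reduce red G e' = reduce (τ : k →+* k) G (reduce red G e)) :
    reduce red G e = reduce (τ.symm : k →+* k) G (reduce red G e') := by
  rw [h, reduce_reduce_of_leftInverse (by simp)]

theorem reduce_brauerMap (f : R →+* k) (P : Subgroup G) (a : MonoidAlgebra R G) :
    reduce f _ (brauerMap P a) = brauerMap P (reduce f G a) := by
  ext g
  simp [coeff_reduce, coeff_brauerMap]

/-- Lets stability be tested over `k`, where the field automorphism visibly preserves it. -/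
theorem fixedBy_reduce_iff (hred : IsCompleteReduction red) {K : Subgroup G} {g : G}
    (hg : ∀ h ∈ K, g * h * g⁻¹ ∈ K) {a : MonoidAlgebra R K}
    (ha : a ∈ Subring.center (MonoidAlgebra R K)) (ha' : IsIdempotentElem a) :
    FixedBy g (reduce red K a) ↔ FixedBy g a := by
  constructor
  · intro h
    have hmul : MonoidAlgebra.single g⁻¹ 1 * MonoidAlgebra.single g 1 =
        (1 : MonoidAlgebra R G) := by
      simp [MonoidAlgebra.single_mul_single, MonoidAlgebra.one_def]
    have hi : IsIdempotentElem
        (MonoidAlgebra.single g 1 * incl R K a * MonoidAlgebra.single g⁻¹ 1) := by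
      rw [IsIdempotentElem]
      calc _ = MonoidAlgebra.single g 1 * incl R K a *
            (MonoidAlgebra.single g⁻¹ 1 * MonoidAlgebra.single g 1) * incl R K a *
            MonoidAlgebra.single g⁻¹ 1 := by simp only [mul_assoc]
        _ = MonoidAlgebra.single g 1 * (incl R K a * incl R K a) *
            MonoidAlgebra.single g⁻¹ 1 := by rw [hmul, mul_one]; simp only [mul_assoc]
        _ = _ := by rw [(ha'.map (incl R K)).eq]
    -- As `g` normalizes `K`, the conjugate of `a` is again in `R K`, where `a` is central. So the
    -- two idempotents commute and are determined by their reductions.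
    obtain ⟨b, hb⟩ := exists_incl_eq (K := K)
      (MonoidAlgebra.single g 1 * incl R K a * MonoidAlgebra.single g⁻¹ 1) (by
        intro x hx
        have : g⁻¹ * x * g ∉ K := fun h' => hx (by simpa [mul_assoc] using hg _ h')
        simpa [mul_assoc] using coeff_incl_of_notMem a this)
    refine hred.eq_of_commute hi (ha'.map _) ?_ ?_
    · rw [← hb]
      exact ((commute_of_mem_center ha b).map (incl R K)).symm
    · unfold FixedBy at h
      rw [map_mul, map_mul, reduce_incl]
      simpa [reduce] using h
  · intro h
    rw [fixedBy_iff_coeff] at h ⊢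
    intro x
    rw [← reduce_incl, coeff_reduce, coeff_reduce, h]

theorem fixedBy_twist_iff (hred : IsCompleteReduction red) (τ : k ≃+* k) {K : Subgroup G} {g : G}
    (hg : ∀ h ∈ K, g * h * g⁻¹ ∈ K) {a a' : MonoidAlgebra R K} (ha : IsBlockIdempotent a)
    (ha' : IsBlockIdempotent a')
    (h : reduce red K a' = reduce (τ : k →+* k) K (reduce red K a)) :
    FixedBy g a' ↔ FixedBy g a := by
  rw [← fixedBy_reduce_iff hred hg ha.1 ha.2.1, ← fixedBy_reduce_iff hred hg ha'.1 ha'.2.1, h,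
    fixedBy_iff_coeff, fixedBy_iff_coeff]
  simp [← reduce_incl, coeff_reduce]

end Lifting

/-! ### Twisting Brauer pairs and self-centralizing pairs -/

theorem conj_mem_centralizer {G : Type*} [Group G] {P : Subgroup G} {g : G}
    (hg : g ∈ Subgroup.normalizer (P : Set G)) {x : G}
    (hx : x ∈ Subgroup.centralizer (P : Set G)) :
    g * x * g⁻¹ ∈ Subgroup.centralizer (P : Set G) := by
  rw [Subgroup.mem_centralizer_iff] at hx ⊢
  intro y hy
  have := hx (g⁻¹ * y * g) (by
    have h := Subgroup.mem_normalizer_iff.1 (inv_mem hg) y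
    simpa using h.1 hy)
  calc y * (g * x * g⁻¹) = g * ((g⁻¹ * y * g) * x) * g⁻¹ := by group
    _ = g * (x * (g⁻¹ * y * g)) * g⁻¹ := by rw [this]
    _ = g * x * g⁻¹ * y := by group

theorem bijective_incl_centralizer_bot {G : Type*} [Group G] {R : Type*} [CommRing R]
    {P : Subgroup G} (hP : P = ⊥) :
    Function.Bijective (incl R (Subgroup.centralizer (P : Set G))) := by
  refine ⟨incl_injective _, fun x => exists_incl_eq x fun g hg => (hg ?_).elim⟩
  subst hP
  simp [Subgroup.mem_centralizer_iff]

namespace BrauerPair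

variable {p : ℕ} {R : Type v} {k : Type u} {G : Type u} [CommRing R] [Field k] [Group G] [Finite G]
  {red : R →+* k}

/-- The Brauer pair obtained from `X` by applying an automorphism of the residue field to the
reduction of its block idempotent. -/
noncomputable def twist (hred : IsCompleteReduction red) (τ : k ≃+* k) (X : BrauerPair p R G) :
    BrauerPair p R G :=
  ⟨X.P, (hred.existsUnique_twist τ X.isBrauerPair.2).choose, X.isBrauerPair.1,
    (hred.existsUnique_twist τ X.isBrauerPair.2).choose_spec.1.1⟩

variable (hred : IsCompleteReduction red) (τ : k ≃+* k)

theorem reduce_twist (X : BrauerPair p R G) : reduce red _ (X.twist hred τ).e =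
    reduce (τ : k →+* k) _ (reduce red _ X.e) :=
  (hred.existsUnique_twist τ X.isBrauerPair.2).choose_spec.1.2

theorem twist_twist {τ τ' : k ≃+* k} (h : ∀ x, τ' (τ x) = x) (X : BrauerPair p R G) :
    (X.twist hred τ).twist hred τ' = X := by
  have h1 := reduce_twist hred τ' (X.twist hred τ)
  have h2 : ((X.twist hred τ).twist hred τ').e = X.e := by
    refine hred.eq_of_commute ((X.twist hred τ).twist hred τ').isBrauerPair.2.2.1
      X.isBrauerPair.2.2.1 (commute_of_mem_center X.isBrauerPair.2.1 _).symm ?_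
    refine h1.trans ((congrArg (reduce (τ' : k →+* k) _) (reduce_twist hred τ X)).trans ?_)
    exact reduce_reduce_of_leftInverse h (reduce red _ X.e)
  cases X
  simp only [twist, BrauerPair.mk.injEq, true_and]
  exact heq_of_eq h2

theorem NormalLE.twist {X Y : BrauerPair p R G} (h : NormalLE red X Y) :
    NormalLE red (X.twist hred τ) (Y.twist hred τ) := by
  obtain ⟨h1, h2, h3, h4⟩ := h
  refine ⟨h1, h2, fun g hg => ?_, ?_⟩
  · exact (fixedBy_twist_iff hred τ (fun x hx => conj_mem_centralizer (h2 hg) hx)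
      X.isBrauerPair.2 (X.twist hred τ).isBrauerPair.2 (reduce_twist hred τ X)).2 (h3 g hg)
  · rw [reduce_twist, reduce_twist]
    have := congrArg (reduce (τ : k →+* k) _) h4
    rwa [map_mul, reduce_brauerMap, reduce_incl] at this

theorem Incl.twist {X Y : BrauerPair p R G} (h : Incl red X Y) :
    Incl red (X.twist hred τ) (Y.twist hred τ) := by
  induction h with
  | refl => exact .refl
  | tail _ h ih => exact ih.tail (NormalLE.twist hred τ h)

/-- A chain of normal inclusions from `({1}, b)` is twisted term by term; its bottom term becomes
`({1}, b')` because `b'` is determined by its reduction. -/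
theorem twist_mem_blockPairs {b b' : MonoidAlgebra R G} (hb' : IsIdempotentElem b')
    (h : reduce red G b' = reduce (τ : k →+* k) G (reduce red G b)) {X : BrauerPair p R G}
    (hX : X ∈ blockPairs red b) : X.twist hred τ ∈ blockPairs red b' := by
  obtain ⟨Y, hY, hYb, hYX⟩ := hX
  refine ⟨Y.twist hred τ, hY, ?_, hYX.twist hred τ⟩
  refine hred.eq_of_commute ((Y.twist hred τ).isBrauerPair.2.2.1.map _) hb' ?_ ?_
  · obtain ⟨c, rfl⟩ := (bijective_incl_centralizer_bot (R := R) (P := (Y.twist hred τ).P) hY).2 b'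
    exact (commute_of_mem_center (Y.twist hred τ).isBrauerPair.2.1 c).map _
  · rw [reduce_incl, reduce_twist, h, ← hYb, reduce_incl, reduce_incl]
    rfl

end BrauerPair

section SelfCentralizing

variable {p : ℕ} {R : Type v} {k : Type u} {G : Type u} [CommRing R] [Field k] [Group G] [Finite G]
  {red : R →+* k} (hred : IsCompleteReduction red) (τ : k ≃+* k) {P : Subgroup G}
  {e e' : MonoidAlgebra R (Subgroup.centralizer (P : Set G))}

include hred

theorem IsSelfCentralizing.twist (he : IsSelfCentralizing p red P e)
    (he' : IsBlockIdempotent e')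
    (h : reduce red _ e' = reduce (τ : k →+* k) _ (reduce red _ e)) :
    IsSelfCentralizing p red P e' := by
  obtain ⟨heP, X, hXP, hXe, hX, hmax⟩ := he
  refine ⟨⟨heP.1, he'⟩, X.twist hred τ, hXP, ?_, ?_, fun Y hY hXY => ?_⟩
  · refine hred.eq_of_commute (((X.twist hred τ).isBrauerPair.2.2.1.map _).map _)
      (he'.2.1.map _) ?_ ?_
    -- The twisted idempotent is supported on `C_G(P)`, hence commutes with `e'`, which is central
    -- in `R C_G(P)`.
    · obtain ⟨c, hc⟩ := exists_incl_eq (K := Subgroup.centralizer (P : Set G))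
        (incl R _ (incl R _ (X.twist hred τ).e)) (by
          intro g hg
          by_cases hg' : g ∈ pc P
          · rw [coeff_incl _ (⟨g, hg'⟩ : pc P), coeff_incl_of_notMem]
            intro hg2
            refine hg (Subgroup.mem_centralizer_iff.2 fun y hy => ?_)
            have hy' : y ∈ pc P := (le_sup_left : P ≤ pc P) hy
            have := Subgroup.mem_centralizer_iff.1 hg2 ⟨y, hy'⟩ (by
              change _ ∈ X.P
              rw [hXP]
              exact hy)
            exact congrArg Subtype.val this
          · exact coeff_incl_of_notMem _ hg')
      rw [← hc]
      exact ((commute_of_mem_center he'.1 c).map _).symm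
    · rw [reduce_incl, reduce_incl, reduce_incl, BrauerPair.reduce_twist, h]
      have := congrArg (fun x => reduce (τ : k →+* k) G (reduce red G x)) hXe
      simpa only [reduce_incl] using! this
  · refine BrauerPair.twist_mem_blockPairs hred τ (he'.2.1.map _) ?_ hX
    rw [reduce_mapDomainRingHom, reduce_mapDomainRingHom, reduce_mapDomainRingHom, h]
  -- A pair above the twist of `X` is twisted back to a pair above `X`, where maximality is known.
  · have h1 := BrauerPair.twist_mem_blockPairs hred τ.symm
      (b' := MonoidAlgebra.mapDomainRingHom R (Subgroup.inclusion (centralizer_le_pc P)) e)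
      (heP.2.2.1.map _) (by
        rw [reduce_mapDomainRingHom, reduce_mapDomainRingHom, reduce_mapDomainRingHom,
          reduce_symm_reduce τ h]) hY
    have h2 := hXY.twist hred τ.symm
    rw [BrauerPair.twist_twist hred (by simp)] at h2
    rw [← hmax _ h1 h2, BrauerPair.twist_twist hred (by simp)]

omit [Finite G] in
theorem pairStabilizer_twist (he : IsBlockIdempotent e) (he' : IsBlockIdempotent e')
    (h : reduce red _ e' = reduce (τ : k →+* k) _ (reduce red _ e)) :
    pairStabilizer P e' = pairStabilizer P e := by
  ext g
  refine and_congr_right fun hg => ?_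
  exact fixedBy_twist_iff hred τ (fun x hx => conj_mem_centralizer hg hx) he he' h

end SelfCentralizing

/-! ### The Brauer homomorphism and the existence of blocks -/

/-- Nontrivial orbits of a `p`-group have length divisible by `p` and contribute zero in
characteristic `p`. The count is made on each level set of `f`, which is stable under `Q`. -/
theorem sum_eq_sum_fixedPoints {p : ℕ} [Fact p.Prime] {k : Type*} [Field k] [CharP k p]
    {Q α : Type*} [Group Q] [Fintype α] [MulAction Q α] (hQ : IsPGroup p Q) {f : α → k}
    (hf : ∀ (g : Q) a, f (g • a) = f a) [DecidablePred (· ∈ MulAction.fixedPoints Q α)] :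
    ∑ a, f a = ∑ a with a ∈ MulAction.fixedPoints Q α, f a := by
  classical
  have hfib : ∀ s : Finset α, ∑ a ∈ s, f a =
      ∑ v ∈ Finset.univ.image f, ((s.filter fun a => f a = v).card : k) * v := by
    intro s
    rw [← Finset.sum_fiberwise_of_maps_to (t := Finset.univ.image f) (g := f) (by simp)]
    refine Finset.sum_congr rfl fun v _ => ?_
    rw [Finset.sum_congr rfl (g := fun _ => v) (by simp), Finset.sum_const, nsmul_eq_mul]
  rw [hfib, hfib]
  refine Finset.sum_congr rfl fun v _ => ?_
  congr 1
  rw [CharP.cast_eq_iff_mod_eq k p]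
  let S : SubMulAction Q α := ⟨{a | f a = v}, fun g {a} ha => (hf g a).trans ha⟩
  have h1 := hQ.card_modEq_card_fixedPoints S
  have h2 : Nat.card S = (Finset.univ.filter fun a => f a = v).card := by
    rw [← Nat.card_eq_finsetCard]
    refine Nat.card_congr (Equiv.subtypeEquivRight fun a => ?_)
    rw [Finset.mem_filter]
    exact (and_iff_right (Finset.mem_univ a)).symm
  have h3 : Nat.card (MulAction.fixedPoints Q S) =
      ((Finset.univ.filter (· ∈ MulAction.fixedPoints Q α)).filter fun a => f a = v).card := by
    rw [← Nat.card_eq_finsetCard]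
    refine Nat.card_congr
      ⟨fun a => ⟨a.1.1, ?_⟩, fun a => ⟨⟨a.1, ?_⟩, fun g => ?_⟩, fun _ => rfl, fun _ => rfl⟩
    · simp only [Finset.mem_filter, Finset.mem_univ, true_and, MulAction.mem_fixedPoints]
      exact ⟨fun g => congrArg Subtype.val (a.2 g), a.1.2⟩
    · exact (Finset.mem_filter.1 a.2).2
    · exact Subtype.ext ((Finset.mem_filter.1 (Finset.mem_filter.1 a.2).1).2 g)
  rw [h2, h3] at h1
  exact h1

theorem coeff_mul_eq_sum {R G : Type*} [CommRing R] [Group G] [Fintype G]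
    (x y : MonoidAlgebra R G) (g : G) :
    (x * y).coeff g = ∑ h, x.coeff h * y.coeff (h⁻¹ * g) := by
  classical
  induction x using MonoidAlgebra.induction_linear with
  | zero => simp
  | add x x' hx hx' => simp [add_mul, hx, hx', Finset.sum_add_distrib]
  | single a r => simp [Finsupp.single_apply]

section BrauerMap

variable {p : ℕ} [Fact p.Prime] {k : Type*} [Field k] [CharP k p] {G : Type*} [Group G] [Finite G]

/-- The coefficient of `a * b` at `c ∈ C_G(Q)` is a sum over `G` of a function invariant under
conjugation by `Q`; only the fixed points, the elements of `C_G(Q)`, contribute. -/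
theorem brauerMap_mul {Q : Subgroup G} (hQ : IsPGroup p Q) {a b : MonoidAlgebra k G}
    (ha : a ∈ Subring.center (MonoidAlgebra k G)) (hb : b ∈ Subring.center (MonoidAlgebra k G)) :
    brauerMap Q (a * b) = brauerMap Q a * brauerMap Q b := by
  classical
  have := Fintype.ofFinite G
  rw [mem_center_iff_coeff] at ha hb
  ext c
  rw [coeff_brauerMap, coeff_mul_eq_sum, coeff_mul_eq_sum]
  let := MulAction.compHom G (MulAut.conj.comp Q.subtype)
  have hsmul : ∀ (q : Q) (x : G), q • x = q * x * (q : G)⁻¹ := fun q x => rfl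
  have hc : ∀ q : Q, (q : G)⁻¹ * c = c * (q : G)⁻¹ := fun q =>
    Subgroup.mem_centralizer_iff.1 c.2 _ (inv_mem q.2)
  rw [sum_eq_sum_fixedPoints hQ]
  · symm
    refine Finset.sum_bij (fun x _ => (x : G)) (fun x _ => ?_) (fun x _ y _ h => Subtype.ext h)
      (fun x hx => ?_) (fun x _ => ?_)
    · simp only [Finset.mem_filter, Finset.mem_univ, true_and, MulAction.mem_fixedPoints]
      intro q
      rw [hsmul, Subgroup.mem_centralizer_iff.1 x.2 _ q.2]
      group
    · simp only [Finset.mem_filter, Finset.mem_univ, true_and, MulAction.mem_fixedPoints] at hx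
      refine ⟨⟨x, Subgroup.mem_centralizer_iff.2 fun q hq => ?_⟩, Finset.mem_univ _, rfl⟩
      have := hx ⟨q, hq⟩
      rw [hsmul, mul_inv_eq_iff_eq_mul] at this
      exact this
    · simp [coeff_brauerMap]
  · intro q x
    rw [hsmul, ha]
    congr 1
    rw [← hb q (x⁻¹ * c)]
    congr 1
    simp only [mul_inv_rev, inv_inv, mul_assoc, hc]

omit [Finite G] in
theorem brauerMap_mem_center (Q : Subgroup G) {a : MonoidAlgebra k G}
    (ha : a ∈ Subring.center (MonoidAlgebra k G)) :
    brauerMap Q a ∈ Subring.center (MonoidAlgebra k (Subgroup.centralizer (Q : Set G))) := by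
  rw [mem_center_iff_coeff] at ha ⊢
  intro g h
  simp [coeff_brauerMap, ha]

end BrauerMap

/-- Among the nonzero central idempotents below `z`, one whose ideal `f A` has least dimension is
primitive. -/
theorem exists_isBlockIdempotent_mul_eq (k : Type*) {A : Type*} [Field k] [Ring A] [Algebra k A]
    [FiniteDimensional k A] {z : A} (hz : z ∈ Subring.center A) (hz' : IsIdempotentElem z)
    (h0 : z ≠ 0) : ∃ f, IsBlockIdempotent f ∧ z * f = f := by
  let S : Set A := {f | f ∈ Subring.center A ∧ IsIdempotentElem f ∧ f ≠ 0 ∧ z * f = f}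
  obtain ⟨f, ⟨hf, hf', hf0, hzf⟩, hmin⟩ := WellFounded.has_min
    (InvImage.wf (fun f : A => Module.finrank k (LinearMap.range (LinearMap.mulLeft k f)))
      wellFounded_lt) S ⟨z, hz, hz', h0, hz'⟩
  refine ⟨f, ⟨hf, hf', hf0, fun c hc d hd hci hdi hcd hsum => ?_⟩, hzf⟩
  by_contra! hne
  have hfc : f * c = c := by
    rw [← hsum, add_mul, hci.eq, (commute_of_mem_center hd c).eq, hcd, add_zero]
  refine hmin c ⟨hc, hci, hne.1, by rw [← hfc, ← mul_assoc, hzf]⟩ ?_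
  refine Submodule.finrank_lt_finrank_of_lt (lt_of_le_of_ne ?_ fun h => hne.2 ?_)
  · rintro _ ⟨x, rfl⟩
    exact ⟨c * x, by simp [← mul_assoc, hfc]⟩
  · have : d ∈ LinearMap.range (LinearMap.mulLeft k c) := by
      rw [h]
      refine ⟨d, ?_⟩
      rw [LinearMap.mulLeft_apply, ← hsum, add_mul, hcd, hdi.eq, zero_add]
    obtain ⟨x, hx⟩ := this
    rw [LinearMap.mulLeft_apply] at hx
    have h2 : c * d = d := by rw [← hx, ← mul_assoc, hci.eq]
    rw [← h2, hcd]

/-! ### Consequences of self-centrality in `P C_G(P)` -/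

theorem pc_le_normalizer {G : Type*} [Group G] (P : Subgroup G) :
    pc P ≤ Subgroup.normalizer (P : Set G) :=
  sup_le Subgroup.le_normalizer (Subgroup.centralizer_le_normalizer _)

instance subgroupOf_pc_normal {G : Type*} [Group G] (P : Subgroup G) :
    (P.subgroupOf (pc P)).Normal :=
  Subgroup.normal_subgroupOf_of_le_normalizer (pc_le_normalizer P)

theorem exists_mul_eq_pc {G : Type*} [Group G] (P : Subgroup G) (h : pc P) :
    ∃ a ∈ P.subgroupOf (pc P), ∃ c ∈ Subgroup.centralizer (P.subgroupOf (pc P) : Set (pc P)),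
      a * c = h := by
  have h1 : P.subgroupOf (pc P) ⊔ (Subgroup.centralizer (P : Set G)).subgroupOf (pc P) = ⊤ :=
    (Subgroup.subgroupOf_sup (B := pc P) le_sup_left (centralizer_le_pc P)).symm.trans
      (Subgroup.subgroupOf_self _)
  have h2 : h ∈ P.subgroupOf (pc P) ⊔ (Subgroup.centralizer (P : Set G)).subgroupOf (pc P) := by
    rw [h1]; trivial
  obtain ⟨a, ha, c, hc, rfl⟩ := Subgroup.mem_sup_of_normal_left.1 h2
  refine ⟨a, ha, c, Subgroup.mem_centralizer_iff.2 fun y hy => Subtype.ext ?_, rfl⟩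
  exact Subgroup.mem_centralizer_iff.1 hc y hy

section SelfCentralizing

variable {p : ℕ} [Fact p.Prime] {R : Type v} {k : Type u} {G : Type u} [CommRing R] [Field k]
  [CharP k p] [Group G] [Finite G] {red : R →+* k} {P : Subgroup G}
  {e : MonoidAlgebra R (Subgroup.centralizer (P : Set G))}

/-- The image of the reduction of `e` in the group algebra of `P C_G(P)` over the residue field. -/
noncomputable def reducedBlock (red : R →+* k)
    (e : MonoidAlgebra R (Subgroup.centralizer (P : Set G))) :
    MonoidAlgebra k (pc P) :=
  MonoidAlgebra.mapDomainRingHom k (Subgroup.inclusion (centralizer_le_pc P)) (reduce red _ e)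

-- The bottom pair `({1}, b)` required by the definition of the `e`-Brauer pairs already says that
-- `e` is a block idempotent of `R[P C_G(P)]`.
omit [Fact p.Prime] [CharP k p] in
theorem IsSelfCentralizing.isBlockIdempotent (hred : IsCompleteReduction red)
    (he : IsSelfCentralizing p red P e) : IsBlockIdempotent (reducedBlock red e) := by
  obtain ⟨-, X, -, -, ⟨Y, hY, hYb, -⟩, -⟩ := he
  have h := Y.isBrauerPair.2.map
    (RingEquiv.ofBijective _ (bijective_incl_centralizer_bot (R := R) hY))
  have h' : IsBlockIdempotent
    (MonoidAlgebra.mapDomainRingHom R (Subgroup.inclusion (centralizer_le_pc P)) e) := by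
    rw [← hYb]; exact h
  rw [reducedBlock, ← reduce_mapDomainRingHom]
  exact (hred.isBlockIdempotent_reduce_iff h'.1 h'.2.1).2 h'

omit [Fact p.Prime] [Finite G] [CharP k p] in
theorem coeff_reducedBlock_of_notMem {h : pc P}
    (hh : h ∉ Subgroup.centralizer (P.subgroupOf (pc P) : Set (pc P))) :
    (reducedBlock red e).coeff h = 0 := by
  refine coeff_mapDomainRingHom_of_notMem _ ?_
  rintro ⟨c, rfl⟩
  refine hh (Subgroup.mem_centralizer_iff.2 fun y hy => Subtype.ext ?_)
  exact Subgroup.mem_centralizer_iff.1 c.2 y hy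

/-- Were `Br_Q` of the block nonzero, it would have a block `f` of `k C(Q)` below it. Then `(Q, f)`,
lifted to `R`, would properly contain the maximal pair. -/
theorem IsSelfCentralizing.coeff_reducedBlock_eq_zero (hred : IsCompleteReduction red)
    (he : IsSelfCentralizing p red P e) {Q : Subgroup (pc P)} (hQ : IsPGroup p Q)
    (hPQ : P.subgroupOf (pc P) < Q) {h : pc P} (hh : h ∈ Subgroup.centralizer (Q : Set (pc P))) :
    (reducedBlock red e).coeff h = 0 := by
  have hb := he.isBlockIdempotent hred
  obtain ⟨-, X, hXP, hXe, hX, hmax⟩ := he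
  suffices hBr : brauerMap Q (reducedBlock red e) = 0 by
    have := coeff_brauerMap (P := Q) (reducedBlock red e) ⟨h, hh⟩
    rw [← this, hBr]
    rfl
  by_contra hne
  obtain ⟨f, hf, hf'⟩ := exists_isBlockIdempotent_mul_eq k (brauerMap_mem_center Q hb.1) (by
    rw [IsIdempotentElem, ← brauerMap_mul hQ hb.1 hb.1, hb.2.1.eq]) hne
  obtain ⟨f, hfc, hfi, rfl⟩ := hred.exists_lift hf.1 hf.2.1
  let Y : BrauerPair p R (pc P) :=
    ⟨Q, f, hQ, (hred.isBlockIdempotent_reduce_iff hfc hfi).1 hf⟩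
  have hXe' : incl R _ X.e =
      MonoidAlgebra.mapDomainRingHom R (Subgroup.inclusion (centralizer_le_pc P)) e := by
    apply incl_injective
    rw [hXe]
    exact RingHom.congr_fun (MonoidAlgebra.mapDomainRingHom_comp (R := R) (pc P).subtype
      (Subgroup.inclusion (centralizer_le_pc P))) e
  have hcen : incl R _ X.e ∈ Subring.center (MonoidAlgebra R (pc P)) := by
    obtain ⟨Y, hY, hYb, -⟩ := hX
    rw [hXe', ← hYb]
    exact map_mem_center (RingEquiv.ofBijective _ (bijective_incl_centralizer_bot hY))
      Y.isBrauerPair.2.1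
  have hXY : BrauerPair.NormalLE red X Y := by
    refine ⟨by rw [hXP]; exact hPQ.le, ?_, fun g _ => ?_, ?_⟩
    · rw [hXP, Subgroup.normalizer_eq_top]
      exact le_top
    · rw [fixedBy_iff_coeff]
      intro x
      simpa using mem_center_iff_coeff.1 hcen g⁻¹ x
    · rw [← reduce_incl, hXe', reduce_mapDomainRingHom]
      exact hf'
  obtain ⟨Y0, hY0, hY0b, hY0X⟩ := hX
  have := hmax Y ⟨Y0, hY0, hY0b, hY0X.tail hXY⟩ (.single hXY)
  refine hPQ.ne ?_
  rw [← hXP, ← this]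

end SelfCentralizing

/-! ### Scalars by which central elements act in a block -/

section CentralCharacters

/-- If `s ≠ t`, the factor `(X - s)^m` of the minimal polynomial of `z` splits off, giving a central
idempotent, polynomial in `z`, that maps to `1` under `φ` and to `0` under `ψ`. It would decompose
`b`. -/
theorem eq_of_isBlockIdempotent {k A B C : Type*} [Field k] [Ring A] [Algebra k A]
    [FiniteDimensional k A] [Ring B] [Algebra k B] [Nontrivial B] [Ring C] [Algebra k C]
    [Nontrivial C] (φ : A →ₐ[k] B) (ψ : A →ₐ[k] C) {b z : A} (hb : IsBlockIdempotent b)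
    (hφb : φ b = 1) (hψb : ψ b = 1) (hz : z ∈ Subring.center A) {s t : k}
    (hs : φ z = algebraMap k B s) (ht : ψ z = algebraMap k C t) : s = t := by
  by_contra hst
  have hm0 : minpoly k z ≠ 0 := minpoly.ne_zero (Algebra.IsIntegral.isIntegral z)
  obtain ⟨g, hg, hgs⟩ := Polynomial.exists_eq_pow_rootMultiplicity_mul_and_not_dvd _ hm0 s
  rw [Polynomial.dvd_iff_isRoot, Polynomial.IsRoot.def] at hgs
  have hcop : IsCoprime ((Polynomial.X - Polynomial.C s) ^ (minpoly k z).rootMultiplicity s) g := by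
    refine IsCoprime.pow_left ((Polynomial.irreducible_X_sub_C s).coprime_iff_not_dvd.2 ?_)
    rwa [Polynomial.dvd_iff_isRoot, Polynomial.IsRoot.def]
  obtain ⟨f, f', hff⟩ := hcop
  set h := (Polynomial.X - Polynomial.C s) ^ (minpoly k z).rootMultiplicity s with hh
  have hpol : ∀ q : Polynomial k, Polynomial.aeval z q ∈ Subring.center A := by
    intro q
    have := (Polynomial.aeval (⟨z, hz⟩ : Subalgebra.center k A) q).2
    rwa [Polynomial.aeval_subalgebra_coe] at this
  have hzero : Polynomial.aeval z (g * h) = 0 := by rw [mul_comm, ← hg, minpoly.aeval]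
  -- By Bézout `f' * g` is congruent to `1` modulo `(X - s)^m` and to `0` modulo `g`, while `t` is a
  -- root of `g`.
  set c := Polynomial.aeval z (f' * g) with hcdef
  have hci : IsIdempotentElem c := by
    rw [IsIdempotentElem, ← sub_eq_zero, hcdef, ← map_mul, ← map_sub]
    have : f' * g * (f' * g) - f' * g = -(f' * f) * (g * h) := by
      linear_combination (f' * g) * hff
    rw [this, map_mul, hzero, mul_zero]
  have hgt : g.eval t = 0 := by
    have h1 : ψ (Polynomial.aeval z (minpoly k z)) = 0 := by rw [minpoly.aeval, map_zero]
    rw [← Polynomial.aeval_algHom_apply, ht, Polynomial.aeval_algebraMap_apply,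
      map_eq_zero_iff _ (FaithfulSMul.algebraMap_injective k C), Polynomial.coe_aeval_eq_eval,
      hg, Polynomial.eval_mul, mul_eq_zero] at h1
    refine h1.resolve_left ?_
    rw [hh, Polynomial.eval_pow, Polynomial.eval_sub, Polynomial.eval_X, Polynomial.eval_C]
    exact pow_ne_zero _ (sub_ne_zero.2 (Ne.symm hst))
  have hφc : φ c = 1 := by
    have hhs : h.eval s = 0 := by
      have h1 : φ (Polynomial.aeval z (minpoly k z)) = 0 := by rw [minpoly.aeval, map_zero]
      rw [← Polynomial.aeval_algHom_apply, hs, Polynomial.aeval_algebraMap_apply,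
        map_eq_zero_iff _ (FaithfulSMul.algebraMap_injective k B), Polynomial.coe_aeval_eq_eval,
        hg, Polynomial.eval_mul, mul_eq_zero] at h1
      exact h1.resolve_right hgs
    have := congrArg (Polynomial.eval s) hff
    rw [Polynomial.eval_add, Polynomial.eval_mul, hhs, mul_zero, zero_add,
      Polynomial.eval_one] at this
    rw [hcdef, ← Polynomial.aeval_algHom_apply, hs, Polynomial.aeval_algebraMap_apply,
      Polynomial.coe_aeval_eq_eval, this, map_one]
  have hψc : ψ c = 0 := by
    rw [hcdef, ← Polynomial.aeval_algHom_apply, ht, Polynomial.aeval_algebraMap_apply,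
      Polynomial.coe_aeval_eq_eval, Polynomial.eval_mul, hgt, mul_zero, map_zero]
  have hcc := hpol (f' * g)
  rw [← hcdef] at hcc
  have hbc := commute_of_mem_center hb.1 c
  rcases hb.2.2.2 (b * c) (mul_mem hb.1 hcc) (b * (1 - c))
    (mul_mem hb.1 (sub_mem (one_mem _) hcc)) (hb.2.1.mul_of_commute hbc hci)
    (hb.2.1.mul_of_commute ((Commute.one_right b).sub_right hbc) hci.one_sub)
    (by rw [mul_assoc, ← mul_assoc c, ← hbc.eq, mul_assoc b, mul_sub, mul_one, hci.eq, sub_self,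
          mul_zero, mul_zero])
    (by rw [← mul_add, add_sub_cancel, mul_one]) with h0 | h0
  · have := congrArg φ h0
    simp [hφb, hφc] at this
  · have := congrArg ψ h0
    simp [hψb, hψc] at this

end CentralCharacters

/-! ### Irreducible representations: normal `p`-subgroups and density -/

section Representations

variable {k H V W : Type*} [Field k] [Group H] [AddCommGroup V] [Module k V] [AddCommGroup W]
  [Module k W] {ρ : Representation k H V} {σ : Representation k H W}

theorem nontrivial_of_isIrreducible [ρ.IsIrreducible] : Nontrivial V := by
  by_contra h
  rw [not_nontrivial_iff_subsingleton] at h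
  exact bot_ne_top (α := Subrepresentation ρ) (SetLike.ext fun x => by
    rw [Subsingleton.elim x 0]; exact iff_of_true (Submodule.zero_mem _) trivial)

/-- A `p`-group acting on a nonzero finite `𝔽_p`-space fixes a nonzero vector, and the fixed vectors
of a normal subgroup form a subrepresentation. -/
theorem apply_eq_one_of_isPGroup {p : ℕ} [Fact p.Prime] [CharP k p] [ρ.IsIrreducible]
    {P : Subgroup H} [P.Normal] [Finite P] (hP : IsPGroup p P) {g : H} (hg : g ∈ P) :
    ρ g = 1 := by
  have := nontrivial_of_isIrreducible (ρ := ρ)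
  obtain ⟨v, hv⟩ := exists_ne (0 : V)
  have hpV : ∀ x : V, p • x = 0 := fun x => by
    rw [← Nat.cast_smul_eq_nsmul k, CharP.cast_eq_zero, zero_smul]
  have : Module (ZMod p) V := AddCommGroup.zmodModule hpV
  -- The `𝔽_p`-span of one `P`-orbit is finite, which allows counting even if `k` is infinite.
  let M : Submodule (ZMod p) V := Submodule.span (ZMod p) (Set.range fun u : P => ρ u v)
  have hfin : Finite ↥M := by
    have : Module.Finite (ZMod p) M := .span_of_finite _ (Set.finite_range _)
    exact Module.finite_of_finite (ZMod p)
  have hM : ∀ (u : P) (x : V), x ∈ M → ρ u x ∈ M := by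
    intro u x hx
    have : M ≤ M.comap ((ρ u).toAddMonoidHom.toZModLinearMap p) := by
      refine Submodule.span_le.2 ?_
      rintro _ ⟨w, rfl⟩
      refine Submodule.subset_span ⟨u * w, ?_⟩
      simp
    exact this hx
  let act : MulAction P M :=
    { smul := fun u x => ⟨ρ u x, hM u x x.2⟩
      one_smul := fun x => Subtype.ext (by change ρ ((1 : P) : H) (x : V) = x; simp)
      mul_smul := fun u w x => Subtype.ext (by
        change ρ ((u * w : P) : H) (x : V) = ρ u (ρ w x); simp) }
  have hvM : v ∈ M := Submodule.subset_span ⟨1, by simp⟩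
  have hcard : p ∣ Nat.card M := by
    have h1 : addOrderOf (⟨v, hvM⟩ : M) = p :=
      addOrderOf_eq_prime (Subtype.ext (hpV v)) fun h => hv (congrArg Subtype.val h)
    exact h1.symm.dvd.trans (addOrderOf_dvd_natCard _)
  obtain ⟨w, hw, hw0⟩ := hP.exists_fixed_point_of_prime_dvd_card_of_fixed_point M hcard (a := 0)
    (fun u => Subtype.ext (map_zero (ρ u)))
  let S : Subrepresentation ρ :=
    { toSubmodule :=
        { carrier := {x | ∀ u ∈ P, ρ u x = x}
          add_mem' := fun hx hy u hu => by rw [map_add, hx u hu, hy u hu]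
          zero_mem' := fun u _ => map_zero _
          smul_mem' := fun c x hx u hu => by rw [map_smul, hx u hu] }
      apply_mem_toSubmodule := fun h x hx u hu => by
        have := hx (h⁻¹ * u * h) (by simpa using ‹P.Normal›.conj_mem u hu h⁻¹)
        calc ρ u (ρ h x) = ρ h (ρ (h⁻¹ * u * h) x) := by
              simp only [← Module.End.mul_apply, ← map_mul]; congr 2; group
          _ = ρ h x := by rw [this] }
  have hS : S = ⊤ := by
    refine (eq_bot_or_eq_top S).resolve_left fun h => hw0 (Subtype.ext ?_)
    have h1 : (w : V) ∈ S := fun u hu => congrArg Subtype.val (hw ⟨u, hu⟩)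
    rw [h] at h1
    exact (show (w : V) = 0 from h1).symm
  ext x
  have : x ∈ S := by rw [hS]; trivial
  exact this g hg

theorem exists_asAlgebraHom_eq_one_eq_zero [FiniteDimensional k V] [FiniteDimensional k W]
    [ρ.IsIrreducible] [σ.IsIrreducible] (h : IsEmpty (ρ.Equiv σ)) :
    ∃ a : MonoidAlgebra k H, ρ.asAlgebraHom a = 1 ∧ σ.asAlgebraHom a = 0 := by
  classical
  have hρσ : ∀ f : ρ.asModule →ₗ[MonoidAlgebra k H] σ.asModule, f = 0 := fun f => by
    have : Subsingleton (ρ.IntertwiningMap σ) := inferInstance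
    obtain ⟨f, rfl⟩ := (Representation.IntertwiningMap.equivLinearMapAsModule ρ σ).surjective f
    rw [Subsingleton.elim f 0, map_zero]
  have h' : IsEmpty (σ.Equiv ρ) := ⟨fun f => h.false f.symm⟩
  have hσρ : ∀ f : σ.asModule →ₗ[MonoidAlgebra k H] ρ.asModule, f = 0 := fun f => by
    have : Subsingleton (σ.IntertwiningMap ρ) := inferInstance
    obtain ⟨f, rfl⟩ := (Representation.IntertwiningMap.equivLinearMapAsModule σ ρ).surjective f
    rw [Subsingleton.elim f 0, map_zero]
  let A := MonoidAlgebra k H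
  let E := Module.End A (ρ.asModule × σ.asModule)
  -- The projection to the first summand commutes with all endomorphisms because there are no
  -- nonzero maps between the summands. Density then realizes it on a basis by an element of the
  -- group algebra.
  let f : Module.End E (ρ.asModule × σ.asModule) :=
    { toFun := fun x => (x.1, 0)
      map_add' := fun x y => by simp
      map_smul' := fun φ x => by
        have h1 : (φ (0, x.2)).1 = 0 := LinearMap.congr_fun
          (hσρ (LinearMap.fst A _ _ ∘ₗ φ ∘ₗ LinearMap.inr A _ _)) x.2
        have h2 : (φ (x.1, 0)).2 = 0 := LinearMap.congr_fun
          (hρσ (LinearMap.snd A _ _ ∘ₗ φ ∘ₗ LinearMap.inl A _ _)) x.1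
        have h3 : φ x = φ (x.1, 0) + φ (0, x.2) := by rw [← map_add]; simp
        refine Prod.ext ?_ ?_
        · change (φ x).1 = (φ (x.1, 0)).1
          rw [h3, Prod.fst_add, h1, add_zero]
        · exact h2.symm }
  let bV := Module.finBasis k V
  let bW := Module.finBasis k W
  have hss : IsSemisimpleModule A (ρ.asModule × σ.asModule) := by
    have := IsSemisimpleModule.sup
      (p := LinearMap.range (LinearMap.inl A ρ.asModule σ.asModule))
      (q := LinearMap.range (LinearMap.inr A ρ.asModule σ.asModule)) (.range _) (.range _)
    rw [LinearMap.sup_range_inl_inr] at this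
    exact Submodule.topEquiv.isSemisimpleModule_iff.1 this
  obtain ⟨a, ha⟩ := jacobson_density (R := A) f
    (Finset.univ.image (fun i => (ρ.asModuleEquiv.symm (bV i), (0 : σ.asModule))) ∪
      Finset.univ.image (fun i => ((0 : ρ.asModule), σ.asModuleEquiv.symm (bW i))))
  refine ⟨a, bV.ext fun i => ?_, bW.ext fun i => ?_⟩
  · have := congrArg (fun x => ρ.asModuleEquiv x.1)
      (ha (ρ.asModuleEquiv.symm (bV i), 0) (by simp))
    simpa [f, Representation.asModuleEquiv_map_smul] using! this.symm
  · have := congrArg (fun x => σ.asModuleEquiv x.2)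
      (ha (0, σ.asModuleEquiv.symm (bW i)) (by simp))
    simpa [f, Representation.asModuleEquiv_map_smul] using! this.symm

end Representations

/-! ### Relative traces and uniqueness of the irreducible module -/

theorem coeff_conj_eq_of_support_le_centralizer {R H : Type*} [CommRing R] [Group H]
    {P : Subgroup H} {x : MonoidAlgebra R H}
    (hx : ∀ h ∉ Subgroup.centralizer (P : Set H), x.coeff h = 0) {u : H} (hu : u ∈ P) (h : H) :
    x.coeff (u⁻¹ * h * u) = x.coeff h := by
  by_cases hh : h ∈ Subgroup.centralizer (P : Set H)
  · rw [mul_assoc, ← Subgroup.mem_centralizer_iff.1 hh u hu, inv_mul_cancel_left]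
  · rw [hx h hh, hx]
    intro hh'
    refine hh ?_
    have hu' : u ∈ Subgroup.normalizer (P : Set H) := Subgroup.le_normalizer hu
    have := conj_mem_centralizer hu' hh'
    simpa [mul_assoc] using this

section RelativeTrace

variable {k H : Type*} [Field k] [Group H] [Finite H] (P : Subgroup H)

/-- The relative trace `∑ g x g⁻¹`, with `g` running over representatives of `H / P`. -/
noncomputable def relTrace (x : MonoidAlgebra k H) : MonoidAlgebra k H :=
  ∑ᶠ q : H ⧸ P, MonoidAlgebra.single q.out 1 * x * MonoidAlgebra.single q.out⁻¹ 1

theorem map_relTrace {A : Type*} [Ring A] [Algebra k A] (φ : MonoidAlgebra k H →ₐ[k] A)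
    (x : MonoidAlgebra k H) : φ (relTrace P x) =
      ∑ᶠ q : H ⧸ P, φ (MonoidAlgebra.single q.out 1) * φ x *
        φ (MonoidAlgebra.single q.out⁻¹ 1) := by
  have := Fintype.ofFinite (H ⧸ P)
  simp [relTrace, finsum_eq_sum_of_fintype]

omit [Finite H] in
theorem coeff_relTrace [Fintype (H ⧸ P)] (x : MonoidAlgebra k H) (h : H) :
    (relTrace P x).coeff h = ∑ q : H ⧸ P, x.coeff (q.out⁻¹ * h * q.out) := by
  simp [relTrace, finsum_eq_sum_of_fintype, mul_assoc, Finsupp.finsetSum_apply]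

variable {P}

/-- Conjugation permutes the cosets of `P`; invariance under `P` makes the choice of representatives
immaterial. -/
theorem relTrace_mem_center {x : MonoidAlgebra k H}
    (hx : ∀ u ∈ P, ∀ h, x.coeff (u⁻¹ * h * u) = x.coeff h) :
    relTrace P x ∈ Subring.center (MonoidAlgebra k H) := by
  have := Fintype.ofFinite (H ⧸ P)
  rw [mem_center_iff_coeff]
  intro g h
  rw [coeff_relTrace, coeff_relTrace]
  refine Fintype.sum_equiv (MulAction.toPerm g⁻¹) _ _ fun q => ?_
  obtain ⟨u, hu⟩ := QuotientGroup.mk_out_eq_mul P (g⁻¹ * q.out)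
  have h1 : (MulAction.toPerm g⁻¹ q : H ⧸ P) = ((g⁻¹ * q.out : H) : H ⧸ P) := by
    rw [MulAction.toPerm_apply, ← smul_eq_mul, MulAction.Quotient.coe_smul_out]
  rw [h1, hu]
  have h2 := hx u u.2 ((g⁻¹ * q.out)⁻¹ * h * (g⁻¹ * q.out))
  rw [show ((g⁻¹ * q.out * u)⁻¹ * h * (g⁻¹ * q.out * u)) =
    (u : H)⁻¹ * ((g⁻¹ * q.out)⁻¹ * h * (g⁻¹ * q.out)) * u by group, h2]
  congr 1
  group

/-- The elements conjugating `h` to `r` form the coset `g₀ C(r)`, a union of cosets of `P`. -/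
theorem card_quotient_conj_eq {h r g₀ : H} (hr : g₀⁻¹ * h * g₀ = r)
    (hP : P ≤ Subgroup.centralizer {r}) :
    Nat.card {q : H ⧸ P // q.out⁻¹ * h * q.out = r} =
      (P.subgroupOf (Subgroup.centralizer {r})).index := by
  have h1 : Nat.card {g : H // g⁻¹ * h * g = r} = Nat.card (Subgroup.centralizer {r}) := by
    refine Nat.card_congr ⟨fun g => ⟨g₀⁻¹ * g, ?_⟩, fun c => ⟨g₀ * c, ?_⟩, fun g => ?_, fun c => ?_⟩
    · rw [Subgroup.mem_centralizer_singleton_iff]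
      calc g₀⁻¹ * g * r = g₀⁻¹ * g * ((g : H)⁻¹ * h * g) := by rw [g.2]
        _ = g₀⁻¹ * h * g₀ * (g₀⁻¹ * g) := by group
        _ = r * (g₀⁻¹ * g) := by rw [hr]
    · have := Subgroup.mem_centralizer_singleton_iff.1 c.2
      rw [mul_inv_rev, mul_assoc, mul_assoc, ← mul_assoc h, ← mul_assoc g₀⁻¹, ← mul_assoc g₀⁻¹,
        hr, ← this, inv_mul_cancel_left]
    · simp
    · simp
  have h2 : Nat.card {g : H // g⁻¹ * h * g = r} =
      Nat.card {q : H ⧸ P // q.out⁻¹ * h * q.out = r} * Nat.card P := by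
    rw [← Nat.card_prod]
    have hmk : ∀ g : H, ∃ u : P, (g : H ⧸ P).out = g * u := fun g =>
      QuotientGroup.mk_out_eq_mul P g
    have hconj : ∀ (g : H) (u : P), (g * u)⁻¹ * h * (g * u) = r ↔ g⁻¹ * h * g = r := by
      intro g u
      have := Subgroup.mem_centralizer_singleton_iff.1 (hP u.2)
      rw [show (g * u)⁻¹ * h * (g * u) = (u : H)⁻¹ * (g⁻¹ * h * g) * u by group]
      rw [mul_assoc, inv_mul_eq_iff_eq_mul, this, mul_left_inj]
    symm
    refine Nat.card_eq_of_bijective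
      (fun x : {q : H ⧸ P // q.out⁻¹ * h * q.out = r} × P =>
        (⟨x.1.1.out * x.2, (hconj _ _).2 x.1.2⟩ : {g : H // g⁻¹ * h * g = r})) ⟨?_, ?_⟩
    · rintro ⟨⟨q, hq⟩, u⟩ ⟨⟨q', hq'⟩, u'⟩ hxy
      have hxy' : q.out * (u : H) = q'.out * u' := congrArg Subtype.val hxy
      have hqq : q = q' := by
        have := congrArg (fun g : H => (g : H ⧸ P)) hxy'
        simpa using this
      subst hqq
      simpa using hxy'
    · rintro ⟨g, hg⟩
      obtain ⟨u, hu⟩ := hmk g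
      refine ⟨⟨⟨(g : H ⧸ P), by rw [hu, hconj]; exact hg⟩, u⁻¹⟩, Subtype.ext ?_⟩
      simp [hu]
  have h3 := Subgroup.card_mul_index (P.subgroupOf (Subgroup.centralizer {r}))
  rw [Nat.card_congr (Subgroup.subgroupOfEquivOfLe hP).toEquiv, ← h1, h2, mul_comm] at h3
  exact (Nat.eq_of_mul_eq_mul_right Nat.card_pos h3).symm

/-- If `b` is nonzero at `r`, then `P` is a Sylow `p`-subgroup of `C(r)`: a larger one would
centralize `r` and force the coefficient to vanish. So `[C(r) : P]` is invertible in `k`, and each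
class sum occurring in `b` is a trace. -/
theorem exists_relTrace_eq [P.Normal] {p : ℕ} [Fact p.Prime] [CharP k p] (hP : IsPGroup p P)
    {b : MonoidAlgebra k H} (hb : b ∈ Subring.center (MonoidAlgebra k H))
    (hb' : ∀ h ∉ Subgroup.centralizer (P : Set H), b.coeff h = 0)
    (hbQ : ∀ Q : Subgroup H, IsPGroup p Q → P < Q →
      ∀ h ∈ Subgroup.centralizer (Q : Set H), b.coeff h = 0) :
    ∃ c, relTrace P c = b := by
  classical
  have := Fintype.ofFinite (H ⧸ P)
  rw [mem_center_iff_coeff] at hb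
  have hle : ∀ r : H, b.coeff r ≠ 0 → P ≤ Subgroup.centralizer {r} := by
    intro r hr
    have h1 : r ∈ Subgroup.centralizer (P : Set H) := by_contra fun h => hr (hb' r h)
    intro u hu
    rw [Subgroup.mem_centralizer_singleton_iff]
    exact Subgroup.mem_centralizer_iff.1 h1 u hu
  have hidx : ∀ r : H, b.coeff r ≠ 0 →
      (((P.subgroupOf (Subgroup.centralizer {r})).index : ℕ) : k) ≠ 0 := by
    intro r hr hzero
    rw [CharP.cast_eq_zero_iff k p] at hzero
    have hP' : IsPGroup p (P.subgroupOf (Subgroup.centralizer {r})) :=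
      hP.of_equiv (Subgroup.subgroupOfEquivOfLe (hle r hr)).symm
    obtain ⟨S, hS⟩ := hP'.exists_le_sylow
    have hlt : P.subgroupOf (Subgroup.centralizer {r}) < S := by
      refine lt_of_le_of_ne hS fun h => ?_
      rw [h] at hzero
      exact S.not_dvd_index hzero
    refine hr (hbQ ((S : Subgroup (Subgroup.centralizer {r})).map (Subgroup.subtype _))
      (S.2.map _) ?_ r ?_)
    · have := (Subgroup.map_lt_map_iff_of_injective (Subgroup.subtype_injective
        (Subgroup.centralizer {r}))).2 hlt
      rwa [Subgroup.map_subgroupOf_eq_of_le (hle r hr)] at this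
    · rw [Subgroup.mem_centralizer_iff]
      rintro _ ⟨s, -, rfl⟩
      exact Subgroup.mem_centralizer_singleton_iff.1 s.2
  obtain ⟨idx, hidx'⟩ : ∃ f : H → ℕ, ∀ r, f r =
    (P.subgroupOf (Subgroup.centralizer {r})).index := ⟨_, fun _ => rfl⟩
  let rep : H → H := fun h => (ConjClasses.mk h).out
  have hrep : ∀ h, ∃ g : H, g⁻¹ * h * g = rep h := by
    intro h
    have : IsConj h (rep h) := (ConjClasses.mk_eq_mk_iff_isConj.1 (Quotient.out_eq _)).symm
    obtain ⟨g, hg⟩ := isConj_iff.1 this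
    exact ⟨g⁻¹, by rwa [inv_inv]⟩
  have hrep' : ∀ g h : H, rep (g⁻¹ * h * g) = rep h := by
    intro g h
    have : ConjClasses.mk (g⁻¹ * h * g) = ConjClasses.mk h :=
      ConjClasses.mk_eq_mk_iff_isConj.2 (isConj_iff.2 ⟨g, by group⟩)
    simp only [rep, this]
  have hbrep : ∀ h, b.coeff (rep h) = b.coeff h := by
    intro h
    obtain ⟨g, hg⟩ := hrep h
    rw [← hg, ← hb g⁻¹ h, inv_inv]
  -- One representative `r` per class, weighted by `[C(r) : P]⁻¹`: by `card_quotient_conj_eq` each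
  -- conjugate of `r` is hit `[C(r) : P]` times.
  refine ⟨.ofCoeff (Finsupp.equivFunOnFinite.symm fun h => if h = rep h then
    b.coeff h * (idx (rep h) : k)⁻¹ else 0), ?_⟩
  ext h
  rw [coeff_relTrace]
  simp only [Finsupp.equivFunOnFinite_symm_apply_apply, hrep']
  have hbc : ∀ g, b.coeff (g⁻¹ * h * g) = b.coeff h := fun g => by
    rw [← hb g⁻¹ h, inv_inv]
  simp only [hbc]
  rw [← Finset.sum_filter, Finset.sum_const, nsmul_eq_mul]
  by_cases h0 : b.coeff h = 0
  · simp [h0]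
  · have h0' : b.coeff (rep h) ≠ 0 := by rwa [hbrep]
    obtain ⟨g, hg⟩ := hrep h
    have := card_quotient_conj_eq hg (hle _ h0')
    rw [Nat.card_eq_fintype_card, Fintype.card_subtype] at this
    rw [this, hidx', mul_left_comm, mul_inv_cancel₀ (hidx _ h0'), mul_one]

theorem nonempty_equiv_of_isBlockIdempotent [P.Normal] {p : ℕ} [Fact p.Prime] [CharP k p]
    (hP : IsPGroup p P)
    (hPC : ∀ h : H, ∃ a ∈ P, ∃ c ∈ Subgroup.centralizer (P : Set H), a * c = h)
    {b : MonoidAlgebra k H} (hb : IsBlockIdempotent b)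
    (hb' : ∀ h ∉ Subgroup.centralizer (P : Set H), b.coeff h = 0)
    (hbQ : ∀ Q : Subgroup H, IsPGroup p Q → P < Q →
      ∀ h ∈ Subgroup.centralizer (Q : Set H), b.coeff h = 0)
    {V W : Type*} [AddCommGroup V] [Module k V] [AddCommGroup W] [Module k W]
    [FiniteDimensional k V] [FiniteDimensional k W]
    {ρ : Representation k H V} {σ : Representation k H W}
    [hρ : ρ.IsIrreducible] [hσ : σ.IsIrreducible] (hρb : ρ.asAlgebraHom b = 1)
    (hσb : σ.asAlgebraHom b = 1) :
    Nonempty (ρ.Equiv σ) := by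
  by_contra hne
  rw [not_nonempty_iff] at hne
  obtain ⟨a, ha1, ha0⟩ := exists_asAlgebraHom_eq_one_eq_zero hne
  obtain ⟨c, hc⟩ := exists_relTrace_eq hP hb.1 hb' hbQ
  -- The trace of `a * c` need not be central. Since `P` acts trivially and `H = P C(P)`, it can be
  -- replaced by an element supported on `C(P)`, hence fixed by `P`, with the same action on both
  -- modules.
  have key : ∀ x : MonoidAlgebra k H, ∃ d : MonoidAlgebra k H,
      (∀ h ∉ Subgroup.centralizer (P : Set H), d.coeff h = 0) ∧
      ρ.asAlgebraHom d = ρ.asAlgebraHom x ∧ σ.asAlgebraHom d = σ.asAlgebraHom x := by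
    intro x
    induction x using MonoidAlgebra.induction_linear with
    | zero => exact ⟨0, by simp, rfl, rfl⟩
    | add x y hx hy =>
      obtain ⟨d, h1, h2, h3⟩ := hx
      obtain ⟨d', h1', h2', h3'⟩ := hy
      exact ⟨d + d', fun h hh => by simp [h1 h hh, h1' h hh], by simp [h2, h2'], by simp [h3, h3']⟩
    | single h r =>
      obtain ⟨u, hu, c, hc, rfl⟩ := hPC h
      refine ⟨MonoidAlgebra.single c r, fun h hh => ?_, ?_, ?_⟩
      · classical
        rw [MonoidAlgebra.coeff_single, Finsupp.single_apply, if_neg]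
        rintro rfl
        exact hh hc
      · simp [apply_eq_one_of_isPGroup (ρ := ρ) hP hu]
      · simp [apply_eq_one_of_isPGroup (ρ := σ) hP hu]
  obtain ⟨d, hd, hρd, hσd⟩ := key (a * c)
  have hρw : ρ.asAlgebraHom (relTrace P d) = algebraMap k _ 1 := by
    rw [map_relTrace, hρd, map_mul, ha1, one_mul, ← map_relTrace, hc, hρb, map_one]
  have hσw : σ.asAlgebraHom (relTrace P d) = algebraMap k _ 0 := by
    rw [map_relTrace, hσd, map_mul, ha0]
    simp
  have := nontrivial_of_isIrreducible (ρ := ρ)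
  have := nontrivial_of_isIrreducible (ρ := σ)
  exact one_ne_zero (eq_of_isBlockIdempotent ρ.asAlgebraHom σ.asAlgebraHom hb hρb hσb
    (relTrace_mem_center fun u hu h => coeff_conj_eq_of_support_le_centralizer hd hu h) hρw hσw)

end RelativeTrace

/-! ### Projective extensions and their cohomology classes -/

theorem H2π_unitsRep_eq {k Q : Type u} [Field k] [Group Q]
    {α α' : groupCohomology.cocycles₂ (unitsRep Q k)} (ν : Q → kˣ)
    (h : ∀ x y, (Additive.toMul (α (x, y) : Additive kˣ) : kˣ) * ν (x * y) =
      ν x * ν y * (Additive.toMul (α' (x, y) : Additive kˣ) : kˣ)) :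
    groupCohomology.H2π _ α = groupCohomology.H2π _ α' := by
  refine (groupCohomology.H2π_eq_iff _ _).2 ⟨fun q => Additive.ofMul (ν q), ?_⟩
  funext x
  have h1 : (α x : Additive kˣ) + Additive.ofMul (ν (x.1 * x.2)) =
    Additive.ofMul (ν x.1) + Additive.ofMul (ν x.2) + (α' x : Additive kˣ) := h x.1 x.2
  have h2 : Additive.ofMul (ν x.2) - Additive.ofMul (ν (x.1 * x.2)) +
    Additive.ofMul (ν x.1) = (α x : Additive kˣ) - (α' x : Additive kˣ) := by
    rw [sub_add_eq_add_sub, sub_eq_sub_iff_add_eq_add, add_comm (Additive.ofMul (ν x.2)), ← h1]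
  exact h2

theorem mem_cocycles₂_unitsRep {k Q : Type u} [Field k] [Group Q] {f : Q × Q → kˣ}
    (h : ∀ x y z, f (x * y, z) * f (x, y) = f (y, z) * f (x, y * z)) :
    (fun x => Additive.ofMul (f x)) ∈ groupCohomology.cocycles₂ (unitsRep Q k) := by
  refine (groupCohomology.mem_cocycles₂_iff (A := unitsRep Q k)
    (fun x => Additive.ofMul (f x))).2 ?_
  intro x y z
  exact congrArg Additive.ofMul (h x y z)

section ProjectiveExtension

variable {k : Type u} [Field k] {I H : Type u} [Group I] [Group H]
  {V V' : Type*} [AddCommGroup V] [Module k V] [AddCommGroup V'] [Module k V']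

/-- `X` is a projective representation of `I` that extends the representation `Y` of the normal
subgroup `N`, the image of `j : H → I`, is compatible with multiplication by elements of `N`,
and has a factor set that is inflated from the 2-cocycle `α` of `I / N`. -/
structure IsProjectiveExtension (j : H →* I) (N : Subgroup I) [N.Normal]
    (Y : Representation k H V) (X : I → LinearMap.GeneralLinearGroup k V)
    (α : groupCohomology.cocycles₂ (unitsRep (I ⧸ N) k)) : Prop where
  apply_eq : ∀ h, (X (j h) : Module.End k V) = Y h
  map_left : ∀ h x, X (j h * x) = X (j h) * X x
  map_right : ∀ h x, X (x * j h) = X x * X (j h)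
  mul_eq_smul : ∀ x y : I, (X x * X y : Module.End k V) =
    ((Additive.toMul (α ((x : I ⧸ N), (y : I ⧸ N)) : Additive kˣ) : kˣ) : k) •
      (X (x * y) : Module.End k V)

theorem exists_eq_smul_one_of_commute [IsAlgClosed k] [FiniteDimensional k V]
    {Y : Representation k H V} [Y.IsIrreducible] {T : Module.End k V}
    (hT : ∀ h, T * Y h = Y h * T) : ∃ s : k, T = s • 1 := by
  let T' : Y.IntertwiningMap Y := ⟨T, hT⟩
  obtain ⟨s, hs⟩ :=
    Representation.IsIrreducible.algebraMap_intertwiningMap_bijective_of_isAlgClosed.2 T'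
  refine ⟨s, ?_⟩
  have := congrArg Representation.IntertwiningMap.toLinearMap hs
  exact this.symm

variable {j : H →* I} {N : Subgroup I} [N.Normal]

theorem exists_map_eq_conj (hj : j.range = N) (x : I) (h : H) : ∃ h', j h' = x * j h * x⁻¹ := by
  have h1 : x * j h * x⁻¹ ∈ N := ‹N.Normal›.conj_mem _ (hj ▸ ⟨h, rfl⟩) x
  rw [← hj] at h1
  exact h1

theorem IsProjectiveExtension.intertwines {Y : Representation k H V}
    {X : I → LinearMap.GeneralLinearGroup k V}
    {α : groupCohomology.cocycles₂ (unitsRep (I ⧸ N) k)} (hX : IsProjectiveExtension j N Y X α)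
    {x : I} {h h' : H} (hh : j h' = x * j h * x⁻¹) :
    (X x : Module.End k V) * Y h = Y h' * (X x : Module.End k V) := by
  rw [← hX.apply_eq, ← hX.apply_eq, ← Units.val_mul, ← Units.val_mul, ← hX.map_right,
    ← hX.map_left, hh, inv_mul_cancel_right]

/-- By Schur's lemma, `X` transported along `φ` differs from `X'` by scalars `ν x`. These are
constant on cosets of `N`, and their coboundary is the difference of the cocycles. -/
theorem IsProjectiveExtension.H2π_eq [IsAlgClosed k] [FiniteDimensional k V']
    (hj : j.range = N) {Y : Representation k H V} {Y' : Representation k H V'} [Y'.IsIrreducible]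
    (φ : Y.Equiv Y') {X : I → LinearMap.GeneralLinearGroup k V}
    {X' : I → LinearMap.GeneralLinearGroup k V'}
    {α α' : groupCohomology.cocycles₂ (unitsRep (I ⧸ N) k)}
    (hX : IsProjectiveExtension j N Y X α) (hX' : IsProjectiveExtension j N Y' X' α') :
    groupCohomology.H2π _ α = groupCohomology.H2π _ α' := by
  have hnt := nontrivial_of_isIrreducible (ρ := Y')
  have hφ : ∀ h v, φ (Y h v) = Y' h (φ v) := fun h v =>
    Representation.IntertwiningMap.isIntertwining _ _ φ.toIntertwiningMap h v
  have hYX : ∀ {x : I} {h h' : H}, j h' = x * j h * x⁻¹ → ∀ v,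
      (X x : Module.End k V) (Y h v) = Y h' ((X x : Module.End k V) v) := fun hh v =>
    LinearMap.congr_fun (hX.intertwines hh) v
  have hν : ∀ x, ∃ s : kˣ, ∀ v, φ ((X x : Module.End k V) v) =
      (s : k) • (X' x : Module.End k V') (φ v) := by
    intro x
    let T : Module.End k V' := ((X' x)⁻¹ : LinearMap.GeneralLinearGroup k V') *
      (φ.toLinearEquiv.toLinearMap ∘ₗ (X x : Module.End k V) ∘ₗ φ.toLinearEquiv.symm.toLinearMap)
    have hT : ∀ v, (X' x : Module.End k V') (T (φ v)) = φ ((X x : Module.End k V) v) := by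
      intro v
      have h1 : (X' x : Module.End k V') * T =
          φ.toLinearEquiv.toLinearMap ∘ₗ (X x : Module.End k V) ∘ₗ
            φ.toLinearEquiv.symm.toLinearMap := by
        simp only [T]
        rw [← mul_assoc, Units.mul_inv, one_mul]
      have h2 := LinearMap.congr_fun h1 (φ v)
      have h3 : φ.toLinearEquiv.symm (φ v) = v := φ.toLinearEquiv.symm_apply_apply v
      rw [Module.End.mul_apply, LinearMap.comp_apply, LinearMap.comp_apply] at h2
      rw [h2]
      change φ ((X x : Module.End k V) (φ.toLinearEquiv.symm (φ v))) = _
      rw [h3]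
    have hinj : Function.Injective (X' x : Module.End k V') := fun v w hvw => by
      have := congrArg ((((X' x)⁻¹ : LinearMap.GeneralLinearGroup k V') : Module.End k V')) hvw
      rwa [← Module.End.mul_apply, ← Module.End.mul_apply, Units.inv_mul] at this
    obtain ⟨s, hs⟩ := exists_eq_smul_one_of_commute (Y := Y') (T := T) (by
      intro h
      ext w
      obtain ⟨v, rfl⟩ := φ.toLinearEquiv.surjective w
      obtain ⟨h', hh'⟩ := exists_map_eq_conj hj x h
      apply hinj
      change (X' x : Module.End k V') (T (Y' h (φ v))) = (X' x : Module.End k V') (Y' h (T (φ v)))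
      rw [← hφ, hT, hYX hh', hφ, ← hT]
      exact (LinearMap.congr_fun (hX'.intertwines hh') (T (φ v))).symm)
    have hs0 : s ≠ 0 := by
      rintro rfl
      obtain ⟨w, hw⟩ := exists_ne (0 : V')
      obtain ⟨v, hv⟩ := φ.toLinearEquiv.surjective w
      obtain ⟨v, rfl⟩ : ∃ v', (X x : Module.End k V) v' = v :=
        ⟨(((X x)⁻¹ : LinearMap.GeneralLinearGroup k V) : Module.End k V) v, by
          rw [← Module.End.mul_apply, Units.mul_inv, Module.End.one_apply]⟩
      refine hw (hv.symm.trans ((hT v).symm.trans ?_))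
      rw [hs]
      simp
    refine ⟨Units.mk0 s hs0, fun v => ?_⟩
    rw [← hT, hs]
    simp
  choose ν hν using hν
  have key : ∀ {s t : k} {x : I}, (∀ v, s • (X' x : Module.End k V') (φ v) =
      t • (X' x : Module.End k V') (φ v)) → s = t := by
    intro s t x hst
    obtain ⟨w, hw⟩ := exists_ne (0 : V')
    obtain ⟨v, hv⟩ : ∃ v, (X' x : Module.End k V') (φ v) = w := by
      obtain ⟨v, hv⟩ := φ.toLinearEquiv.surjective
        ((((X' x)⁻¹ : LinearMap.GeneralLinearGroup k V') : Module.End k V') w)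
      refine ⟨v, ?_⟩
      change (X' x : Module.End k V') (φ.toLinearEquiv v) = w
      rw [hv, ← Module.End.mul_apply, Units.mul_inv, Module.End.one_apply]
    have := hst v
    rw [hv] at this
    exact smul_left_injective k hw this
  have hνN : ∀ x h, ν (x * j h) = ν x := by
    intro x h
    refine Units.ext (key (x := x * j h) fun v => ?_)
    rw [← hν, hX.map_right, hX'.map_right]
    simp only [Units.val_mul, Module.End.mul_apply, hX.apply_eq, hX'.apply_eq, hν, hφ]
  let ν' : I ⧸ N → kˣ := fun q => ν q.out
  have hν' : ∀ x : I, ν' x = ν x := by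
    intro x
    obtain ⟨n, hn⟩ := QuotientGroup.mk_out_eq_mul N x
    obtain ⟨h, hh⟩ : (n : I) ∈ j.range := hj ▸ n.2
    simp only [ν']
    rw [hn, ← hh, hνN]
  refine H2π_unitsRep_eq ν' fun q q' => ?_
  induction q using QuotientGroup.induction_on with | _ x
  induction q' using QuotientGroup.induction_on with | _ y
  rw [← QuotientGroup.mk_mul, hν', hν', hν']
  refine Units.ext (key (x := x * y) fun v => ?_)
  have h2 := LinearMap.congr_fun (hX.mul_eq_smul x y) v
  have h3 := LinearMap.congr_fun (hX'.mul_eq_smul x y) (φ v)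
  have h4 := congrArg φ h2
  rw [Module.End.mul_apply, hν, hν, map_smul, LinearMap.smul_apply] at h4
  rw [Module.End.mul_apply, LinearMap.smul_apply] at h3
  rw [h3] at h4
  rw [map_smul] at h4
  rw [hν] at h4
  simp only [Units.val_mul, mul_smul]
  exact h4.symm

end ProjectiveExtension

section Existence

variable {k : Type u} [Field k] {I H : Type u} [Group I] [Group H]
  {V : Type*} [AddCommGroup V] [Module k V] {j : H →* I} {N : Subgroup I} [N.Normal]

/-- Choose intertwiners on coset representatives and extend by `Y` along `N`; right compatibility is
built in, and left compatibility follows from the intertwining property. -/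
theorem exists_multiplicative_extension (hj : j.range = N) (hj' : Function.Injective j)
    {Y : Representation k H V}
    (hY : ∀ x : I, ∃ T : LinearMap.GeneralLinearGroup k V, ∀ h h', j h' = x * j h * x⁻¹ →
      (T : Module.End k V) * Y h = Y h' * (T : Module.End k V)) :
    ∃ X : I → LinearMap.GeneralLinearGroup k V,
      (∀ h, (X (j h) : Module.End k V) = Y h) ∧ (∀ h x, X (j h * x) = X (j h) * X x) ∧
      ∀ h x, X (x * j h) = X x * X (j h) := by
  classical
  let U : H →* LinearMap.GeneralLinearGroup k V := Y.toHomUnits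
  have hU : ∀ h, (U h : Module.End k V) = Y h := fun h => rfl
  -- The representative of the trivial coset need not be `1`; prescribing `T` on all of `N` makes
  -- `X` restrict to `Y` exactly.
  have hT : ∀ x : I, ∃ T : LinearMap.GeneralLinearGroup k V,
      (∀ h h', j h' = x * j h * x⁻¹ → T * U h = U h' * T) ∧ ∀ h, j h = x → T = U h := by
    intro x
    by_cases hx : x ∈ j.range
    · obtain ⟨h₀, rfl⟩ := hx
      refine ⟨U h₀, fun h h' hh => ?_, fun h hh => by rw [hj' hh]⟩
      rw [← map_inv, ← map_mul, ← map_mul] at hh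
      rw [hj' hh, ← map_mul, ← map_mul, inv_mul_cancel_right]
    · obtain ⟨T, hT⟩ := hY x
      exact ⟨T, fun h h' hh => Units.ext (hT h h' hh), fun h hh => (hx ⟨h, hh⟩).elim⟩
  choose T hT hTj using hT
  have hι : ∀ x : I, ∃ h, (x : I ⧸ N).out * j h = x := by
    intro x
    obtain ⟨n, hn⟩ := QuotientGroup.mk_out_eq_mul N x
    obtain ⟨h, hh⟩ : (n : I) ∈ j.range := hj ▸ n.2
    refine ⟨h⁻¹, ?_⟩
    rw [hn, map_inv, hh, mul_inv_cancel_right]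
  choose ι hι using hι
  have hmk : ∀ x h, ((x * j h : I) : I ⧸ N) = x := by
    intro x h
    rw [QuotientGroup.mk_mul_of_mem]
    exact hj ▸ ⟨h, rfl⟩
  let X : I → LinearMap.GeneralLinearGroup k V := fun x => T (x : I ⧸ N).out * U (ι x)
  have hXU : ∀ h, X (j h) = U h := by
    intro h
    have h1 := hι (j h)
    have h2 : j (h * (ι (j h))⁻¹) = ((j h : I) : I ⧸ N).out := by
      rw [map_mul, map_inv, mul_inv_eq_iff_eq_mul, h1]
    simp only [X]
    rw [hTj _ _ h2, ← map_mul, inv_mul_cancel_right]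
  have hXr : ∀ h x, X (x * j h) = X x * U h := by
    intro h x
    have h1 := hι (x * j h)
    rw [hmk] at h1
    have h2 : ι (x * j h) = ι x * h := by
      apply hj'
      rw [map_mul]
      apply mul_left_cancel (a := (x : I ⧸ N).out)
      rw [h1, ← mul_assoc, hι]
    simp only [X]
    rw [hmk, h2, map_mul, mul_assoc]
  have hXc : ∀ x h h', j h' = x * j h * x⁻¹ → X x * U h = U h' * X x := by
    intro x h h' hh
    have h1 : j h' = (x : I ⧸ N).out * j (ι x * h * (ι x)⁻¹) * (x : I ⧸ N).out⁻¹ := by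
      rw [hh]
      nth_rewrite 1 2 [← hι x]
      simp only [map_mul, map_inv, mul_inv_rev, mul_assoc]
    have h2 := hT _ _ _ h1
    simp only [X]
    rw [← mul_assoc, ← h2, mul_assoc, mul_assoc, ← map_mul, ← map_mul, inv_mul_cancel_right]
  refine ⟨X, fun h => by rw [hXU, hU], fun h x => ?_, fun h x => by rw [hXr, hXU]⟩
  obtain ⟨h', hh'⟩ := exists_map_eq_conj hj x⁻¹ h
  have h1 : j h * x = x * j h' := by rw [hh']; group
  rw [h1, hXr, hXU]
  exact hXc x h' h (by rw [hh']; group)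

/-- `X x * X y * (X (x * y))⁻¹` commutes with `Y`, hence is a scalar. Compatibility with `N` makes
it depend only on cosets, and associativity is the cocycle identity. -/
theorem exists_isProjectiveExtension [IsAlgClosed k] [FiniteDimensional k V]
    (hj : j.range = N) (hj' : Function.Injective j)
    {Y : Representation k H V} [Y.IsIrreducible]
    (hY : ∀ x : I, ∃ T : LinearMap.GeneralLinearGroup k V, ∀ h h', j h' = x * j h * x⁻¹ →
      (T : Module.End k V) * Y h = Y h' * (T : Module.End k V)) :
    ∃ X α, IsProjectiveExtension j N Y X α := by
  have hnt := nontrivial_of_isIrreducible (ρ := Y)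
  obtain ⟨X, hXY, hXl, hXr⟩ := exists_multiplicative_extension hj hj' hY
  have hXc : ∀ x h h', j h' = x * j h * x⁻¹ → X x * X (j h) = X (j h') * X x := by
    intro x h h' hh
    rw [← hXr, ← hXl, hh, inv_mul_cancel_right]
  have hXc' : ∀ x h h', j h' = x * j h * x⁻¹ → (X x)⁻¹ * X (j h') = X (j h) * (X x)⁻¹ := by
    intro x h h' hh
    rw [inv_mul_eq_iff_eq_mul, ← mul_assoc, hXc x h h' hh, mul_inv_cancel_right]
  have hμ : ∀ x y, ∃ s : kˣ, (X x * X y : Module.End k V) =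
      (s : k) • (X (x * y) : Module.End k V) := by
    intro x y
    obtain ⟨s, hs⟩ := exists_eq_smul_one_of_commute (Y := Y)
      (T := ((X x * X y * (X (x * y))⁻¹ : LinearMap.GeneralLinearGroup k V) : Module.End k V)) (by
        intro h
        rw [← hXY, ← Units.val_mul, ← Units.val_mul]
        congr 1
        obtain ⟨h₁, hh₁⟩ := exists_map_eq_conj hj (x * y)⁻¹ h
        obtain ⟨h₂, hh₂⟩ := exists_map_eq_conj hj y h₁
        have e1 : j h = x * j h₂ * x⁻¹ := by rw [hh₂, hh₁]; group
        have e2 : j h = (x * y) * j h₁ * (x * y)⁻¹ := by rw [hh₁]; group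
        rw [mul_assoc, hXc' (x * y) h₁ h e2, ← mul_assoc, mul_assoc (X x), hXc y h₁ h₂ hh₂,
          ← mul_assoc, hXc x h₂ h e1, mul_assoc, mul_assoc, mul_assoc])
    have hs0 : s ≠ 0 := by
      rintro rfl
      rw [zero_smul] at hs
      exact (X x * X y * (X (x * y))⁻¹).ne_zero hs
    refine ⟨Units.mk0 s hs0, ?_⟩
    calc (X x * X y : Module.End k V)
        = ((X x * X y * (X (x * y))⁻¹ : LinearMap.GeneralLinearGroup k V) : Module.End k V) *
            X (x * y) := by
          rw [← Units.val_mul, ← Units.val_mul, inv_mul_cancel_right]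
      _ = _ := by rw [hs, smul_mul_assoc, one_mul]; rfl
  choose μ hμ using hμ
  have key : ∀ {s t : kˣ} {x : I}, (s : k) • (X x : Module.End k V) =
      (t : k) • (X x : Module.End k V) → s = t := fun {s t x} h =>
    Units.ext (smul_left_injective k (X x).ne_zero h)
  have hμl : ∀ x y h, μ (x * j h) y = μ x y := by
    intro x y h
    obtain ⟨h', hh'⟩ := exists_map_eq_conj hj y⁻¹ h
    have e1 : j h * y = y * j h' := by rw [hh']; group
    refine key (x := x * j h * y) ?_
    rw [← hμ, hXr, mul_assoc, e1, ← mul_assoc, hXr, Units.val_mul, Units.val_mul, ← smul_mul_assoc,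
      ← hμ, mul_assoc, mul_assoc, ← Units.val_mul, ← hXl, e1, hXr, Units.val_mul]
  have hμr : ∀ x y h, μ x (y * j h) = μ x y := by
    intro x y h
    refine key (x := x * (y * j h)) ?_
    rw [← hμ, hXr, ← mul_assoc x, hXr, Units.val_mul, Units.val_mul, ← smul_mul_assoc,
      ← hμ, mul_assoc]
  have hout : ∀ x : I, ∃ h, (x : I ⧸ N).out = x * j h := by
    intro x
    obtain ⟨n, hn⟩ := QuotientGroup.mk_out_eq_mul N x
    obtain ⟨h, hh⟩ : (n : I) ∈ j.range := hj ▸ n.2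
    exact ⟨h, by rw [hn, hh]⟩
  let f : (I ⧸ N) × (I ⧸ N) → kˣ := fun q => μ q.1.out q.2.out
  have hf : ∀ x y : I, f ((x : I ⧸ N), (y : I ⧸ N)) = μ x y := by
    intro x y
    obtain ⟨h, hh⟩ := hout x
    obtain ⟨h', hh'⟩ := hout y
    simp only [f]
    rw [hh, hh', hμl, hμr]
  refine ⟨X, ⟨_, mem_cocycles₂_unitsRep (f := f) fun q₁ q₂ q₃ => ?_⟩, hXY, hXl,
    fun h x => hXr h x, fun x y => ?_⟩
  · induction q₁ using QuotientGroup.induction_on with | _ x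
    induction q₂ using QuotientGroup.induction_on with | _ y
    induction q₃ using QuotientGroup.induction_on with | _ z
    rw [← QuotientGroup.mk_mul, ← QuotientGroup.mk_mul, hf, hf, hf, hf]
    refine key (x := x * y * z) ?_
    rw [Units.val_mul, Units.val_mul, mul_comm, mul_smul, ← hμ, ← smul_mul_assoc, ← hμ, mul_smul,
      mul_assoc x, ← hμ, ← mul_smul_comm, ← hμ, mul_assoc]
  · rw [hμ, ← hf]
    rfl

end Existence

/-! ### Frobenius twists of representations -/

section Frobenius

variable {p : ℕ} [Fact p.Prime] {k : Type u} [Field k] [CharP k p] {n : ℕ}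

variable (k p n) in
/-- The Frobenius endomorphism of the ring of endomorphisms of `kⁿ`: it raises the matrix
coefficients to the `p`-th power. -/
noncomputable def frobeniusEnd : Module.End k (Fin n → k) →+* Module.End k (Fin n → k) :=
  (Matrix.toLinAlgEquiv' : Matrix (Fin n) (Fin n) k ≃ₐ[k] _).toRingHom.comp
    ((frobenius k p).mapMatrix.comp
      (LinearMap.toMatrixAlgEquiv' : _ ≃ₐ[k] Matrix (Fin n) (Fin n) k).toRingHom)

theorem frobeniusEnd_apply (T : Module.End k (Fin n → k)) (v : Fin n → k) :
    frobeniusEnd p k n T (fun i => frobenius k p (v i)) = fun i => frobenius k p (T v i) := by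
  ext i
  have h1 : T v = (LinearMap.toMatrixAlgEquiv' T).mulVec v := by
    rw [← Matrix.toLinAlgEquiv'_apply, Matrix.toLinAlgEquiv'_toMatrixAlgEquiv']
  rw [h1]
  simp [frobeniusEnd, Matrix.mulVec, dotProduct]

theorem frobeniusEnd_smul (s : k) (T : Module.End k (Fin n → k)) :
    frobeniusEnd p k n (s • T) = s ^ p • frobeniusEnd p k n T := by
  have h1 : ∀ M : Matrix (Fin n) (Fin n) k,
      (frobenius k p).mapMatrix (s • M) = s ^ p • (frobenius k p).mapMatrix M := by
    intro M
    ext i j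
    simp [frobenius_def, mul_pow]
  change Matrix.toLinAlgEquiv' ((frobenius k p).mapMatrix (LinearMap.toMatrixAlgEquiv' (s • T))) = _
  rw [map_smul, h1, map_smul]
  rfl

variable {H I : Type u} [Group H] [Group I]

/-- The representation obtained from `Y` by raising the matrix coefficients to the `p`-th power. -/
noncomputable def frobeniusTwist (p : ℕ) [Fact p.Prime] [CharP k p]
    (Y : Representation k H (Fin n → k)) : Representation k H (Fin n → k) :=
  (frobeniusEnd p k n : Module.End k (Fin n → k) →* Module.End k (Fin n → k)).comp Y

theorem frobeniusTwist_apply (Y : Representation k H (Fin n → k)) (h : H) :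
    frobeniusTwist p Y h = frobeniusEnd p k n (Y h) := rfl

theorem frobeniusTwist_asAlgebraHom (Y : Representation k H (Fin n → k)) (a : MonoidAlgebra k H) :
    (frobeniusTwist p Y).asAlgebraHom (reduce (frobenius k p) H a) =
      frobeniusEnd p k n (Y.asAlgebraHom a) := by
  induction a using MonoidAlgebra.induction_linear with
  | zero => simp
  | add a b ha hb => simp only [map_add, ha, hb]
  | single h r =>
    rw [reduce, MonoidAlgebra.mapRingHom_single, Representation.asAlgebraHom_single,
      Representation.asAlgebraHom_single, frobeniusEnd_smul, frobeniusTwist_apply, frobenius_def]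

/-- The coordinatewise Frobenius of `kⁿ` is a semilinear bijection, as `k` is perfect;
subrepresentations are pulled back along it. -/
theorem frobeniusTwist_isIrreducible [IsAlgClosed k] (Y : Representation k H (Fin n → k))
    [hY : Y.IsIrreducible] : (frobeniusTwist p Y).IsIrreducible := by
  have hnt := nontrivial_of_isIrreducible (ρ := Y)
  have hsurj : ∀ v : Fin n → k, ∃ w : Fin n → k, (fun i => frobenius k p (w i)) = v := by
    intro v
    choose w hw using fun i => (bijective_frobenius k p).2 (v i)
    exact ⟨w, funext hw⟩
  have hnt' : Nontrivial (Subrepresentation (frobeniusTwist p Y)) := by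
    refine ⟨⊥, ⊤, fun h => ?_⟩
    obtain ⟨v, hv⟩ := exists_ne (0 : Fin n → k)
    have h1 : v ∈ (⊤ : Subrepresentation (frobeniusTwist p Y)) := trivial
    rw [← h] at h1
    exact hv h1
  refine { eq_bot_or_eq_top := fun S => ?_ }
  let S' : Subrepresentation Y :=
    { toSubmodule :=
        { carrier := {v | (fun i => frobenius k p (v i)) ∈ S.toSubmodule}
          add_mem' := fun {v w} hv hw => by
            change (fun i => frobenius k p ((v + w) i)) ∈ S.toSubmodule
            have := S.toSubmodule.add_mem hv hw
            convert this using 1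
            ext i
            simp
          zero_mem' := by
            change (fun i => frobenius k p ((0 : Fin n → k) i)) ∈ S.toSubmodule
            convert S.toSubmodule.zero_mem using 1
            ext i
            simp
          smul_mem' := fun c v hv => by
            change (fun i => frobenius k p ((c • v) i)) ∈ S.toSubmodule
            have := S.toSubmodule.smul_mem (frobenius k p c) hv
            convert this using 1
            ext i
            simp }
      apply_mem_toSubmodule := fun h v hv => by
        have := S.apply_mem_toSubmodule h hv
        rwa [frobeniusTwist_apply, frobeniusEnd_apply] at this }
  refine (hY.eq_bot_or_eq_top S').imp (fun h => ?_) (fun h => ?_)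
  · refine eq_bot_iff.2 fun v hv => ?_
    obtain ⟨w, rfl⟩ := hsurj v
    have h1 : w ∈ S' := hv
    rw [h] at h1
    have h2 : w = 0 := h1
    subst h2
    change (fun i => frobenius k p ((0 : Fin n → k) i)) = 0
    ext i
    simp
  · refine eq_top_iff.2 fun v _ => ?_
    obtain ⟨w, rfl⟩ := hsurj v
    have h1 : w ∈ S' := by rw [h]; trivial
    exact h1

theorem IsProjectiveExtension.frobenius {j : H →* I} {N : Subgroup I} [N.Normal]
    {Y : Representation k H (Fin n → k)} {X : I → LinearMap.GeneralLinearGroup k (Fin n → k)}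
    {α : groupCohomology.cocycles₂ (unitsRep (I ⧸ N) k)} (hX : IsProjectiveExtension j N Y X α) :
    IsProjectiveExtension j N (frobeniusTwist p Y)
      (fun x => Units.map (frobeniusEnd p k n : _ →* _) (X x)) (p • α) := by
  refine ⟨fun h => ?_, fun h x => ?_, fun h x => ?_, fun x y => ?_⟩
  · rw [frobeniusTwist_apply, ← hX.apply_eq]
    rfl
  · rw [hX.map_left, map_mul]
  · rw [hX.map_right, map_mul]
  · have := congrArg (frobeniusEnd p k n) (hX.mul_eq_smul x y)
    rw [map_mul, frobeniusEnd_smul] at this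
    exact this

end Frobenius

/-! ### An irreducible representation in a given block -/

section ExistsIrreducible

variable {k H : Type*} [Field k] [Group H]

theorem exists_representation_fin_asAlgebraHom_eq_one {V : Type*} [AddCommGroup V] [Module k V]
    [FiniteDimensional k V] (ρ : Representation k H V) (b : MonoidAlgebra k H)
    (hb : ρ.asAlgebraHom b = 1) :
    ∃ σ : Representation k H (Fin (Module.finrank k V) → k), σ.asAlgebraHom b = 1 := by
  let e : V ≃ₗ[k] (Fin (Module.finrank k V) → k) := (Module.finBasis k V).equivFun
  let σ : Representation k H (Fin (Module.finrank k V) → k) :=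
    (e.conjAlgEquiv k : Module.End k V →* _).comp ρ
  have h : ∀ a, σ.asAlgebraHom a = e.conjAlgEquiv k (ρ.asAlgebraHom a) := by
    intro a
    induction a using MonoidAlgebra.induction_linear with
    | zero => simp
    | add x y hx hy => simp only [map_add, hx, hy]
    | single h r =>
      rw [Representation.asAlgebraHom_single, Representation.asAlgebraHom_single, map_smul]
      rfl
  exact ⟨σ, by rw [h, hb, map_one]⟩

theorem toRepresentation_asAlgebraHom_apply {V : Type*} [AddCommGroup V] [Module k V]
    {ρ : Representation k H V} (S : Subrepresentation ρ) (a : MonoidAlgebra k H)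
    (v : S.toSubmodule) : (S.toRepresentation.asAlgebraHom a v : V) = ρ.asAlgebraHom a v := by
  induction a using MonoidAlgebra.induction_linear with
  | zero => simp
  | add x y hx hy => simp [hx, hy]
  | single h r =>
    rw [Representation.asAlgebraHom_single, Representation.asAlgebraHom_single]
    rfl

theorem exists_irreducible_asAlgebraHom_eq_one [Finite H] {b : MonoidAlgebra k H}
    (hb : b ∈ Subring.center (MonoidAlgebra k H)) (hb' : IsIdempotentElem b) (hb0 : b ≠ 0) :
    ∃ (n : ℕ) (Y : Representation k H (Fin n → k)), Y.IsIrreducible ∧ Y.asAlgebraHom b = 1 := by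
  classical
  have hex : ∃ n : ℕ, n ≠ 0 ∧ ∃ Y : Representation k H (Fin n → k), Y.asAlgebraHom b = 1 := by
    let ρ : Representation k H (MonoidAlgebra k H) :=
      (Algebra.lmul k (MonoidAlgebra k H) : MonoidAlgebra k H →* _).comp (MonoidAlgebra.of k H)
    have hρ : ∀ a x, ρ.asAlgebraHom a x = a * x := by
      intro a x
      induction a using MonoidAlgebra.induction_linear with
      | zero => simp
      | add y z hy hz => simp [hy, hz, add_mul]
      | single h r =>
        rw [Representation.asAlgebraHom_single, LinearMap.smul_apply]
        change r • (MonoidAlgebra.single h 1 * x) = _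
        rw [← smul_mul_assoc, MonoidAlgebra.smul_single, smul_eq_mul, mul_one]
    let S : Subrepresentation ρ :=
      { toSubmodule := LinearMap.range (LinearMap.mulLeft k b)
        apply_mem_toSubmodule := by
          rintro h _ ⟨x, rfl⟩
          refine ⟨MonoidAlgebra.single h 1 * x, ?_⟩
          change b * (MonoidAlgebra.single h 1 * x) = MonoidAlgebra.single h 1 * (b * x)
          rw [← mul_assoc, ← mul_assoc, (commute_of_mem_center hb _).eq] }
    have hS : S.toRepresentation.asAlgebraHom b = 1 := by
      ext1 ⟨_, x, rfl⟩
      refine Subtype.ext ?_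
      rw [toRepresentation_asAlgebraHom_apply, hρ]
      change b * (b * x) = b * x
      rw [← mul_assoc, hb'.eq]
    refine ⟨_, ?_, exists_representation_fin_asAlgebraHom_eq_one S.toRepresentation b hS⟩
    intro h0
    rw [Submodule.finrank_eq_zero] at h0
    have h1 : b ∈ S.toSubmodule := ⟨1, by simp⟩
    rw [h0] at h1
    exact hb0 h1
  -- In the least positive dimension where `b` can act as the identity, a proper nonzero
  -- subrepresentation would contradict minimality. The ideal `b k H` shows that such a dimension
  -- exists.
  obtain ⟨hn, Y, hY⟩ := Nat.find_spec hex
  refine ⟨Nat.find hex, Y, ?_, hY⟩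
  have : NeZero (Nat.find hex) := ⟨hn⟩
  have hnt : Nontrivial (Subrepresentation Y) := by
    refine ⟨⊥, ⊤, fun h => ?_⟩
    obtain ⟨v, hv⟩ := exists_ne (0 : Fin (Nat.find hex) → k)
    have h1 : v ∈ (⊤ : Subrepresentation Y) := trivial
    rw [← h] at h1
    exact hv h1
  refine { eq_bot_or_eq_top := fun S => ?_ }
  by_cases h0 : Module.finrank k S.toSubmodule = 0
  · rw [Submodule.finrank_eq_zero] at h0
    exact .inl (Subrepresentation.toSubmodule_injective h0)
  · have h1 : Nat.find hex ≤ Module.finrank k S.toSubmodule :=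
      Nat.find_min' hex ⟨h0, exists_representation_fin_asAlgebraHom_eq_one S.toRepresentation b (by
        ext1 v
        refine Subtype.ext ?_
        rw [toRepresentation_asAlgebraHom_apply, hY]
        rfl)⟩
    refine .inr (Subrepresentation.toSubmodule_injective (Submodule.eq_top_of_finrank_eq ?_))
    refine le_antisymm (Submodule.finrank_le _) ?_
    rwa [Module.finrank_fin_fun]

end ExistsIrreducible

/-! ### Conjugate representations -/

section Conjugation

variable {k : Type*} [Field k] {I H : Type u} [Group I] [Group H] {j : H →* I} {N : Subgroup I}
  [N.Normal] {V : Type*} [AddCommGroup V] [Module k V]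

theorem exists_mulEquiv_map_eq_conj (hj : j.range = N) (hj' : Function.Injective j) (x : I) :
    ∃ c : H ≃* H, ∀ h, j (c h) = x * j h * x⁻¹ := by
  choose c hc using exists_map_eq_conj hj
  exact ⟨{ toFun := c x
           invFun := c x⁻¹
           left_inv := fun h => hj' (by rw [hc, hc]; group)
           right_inv := fun h => hj' (by rw [hc, hc]; group)
           map_mul' := fun h h' => hj' (by rw [hc, map_mul, map_mul, hc, hc]; group) }, hc x⟩

theorem isIrreducible_comp_mulEquiv (Y : Representation k H V) [hY : Y.IsIrreducible]
    (c : H ≃* H) : Representation.IsIrreducible (MonoidHom.comp Y (c : H →* H)) := by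
  let f : Subrepresentation (MonoidHom.comp Y (c : H →* H) : Representation k H V) ≃o
      Subrepresentation Y :=
    { toFun := fun S => ⟨S.toSubmodule, fun h v hv => by
        have := S.apply_mem_toSubmodule (c.symm h) hv
        simpa using this⟩
      invFun := fun S => ⟨S.toSubmodule, fun h v hv => S.apply_mem_toSubmodule (c h) hv⟩
      left_inv := fun _ => rfl
      right_inv := fun _ => rfl
      map_rel_iff' := Iff.rfl }
  exact f.isSimpleOrder_iff.2 hY

theorem asAlgebraHom_comp_mulEquiv (Y : Representation k H V) (c : H ≃* H)
    {b : MonoidAlgebra k H} (hb : ∀ h, b.coeff (c h) = b.coeff h) :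
    Representation.asAlgebraHom (MonoidHom.comp Y (c : H →* H)) b = Y.asAlgebraHom b := by
  have h1 : ∀ a : MonoidAlgebra k H, Representation.asAlgebraHom (MonoidHom.comp Y (c : H →* H)) a =
      Y.asAlgebraHom (MonoidAlgebra.mapDomainRingHom k (c : H →* H) a) := by
    intro a
    induction a using MonoidAlgebra.induction_linear with
    | zero => simp
    | add y z hy hz => simp only [map_add, hy, hz]
    | single h r => simp
  rw [h1]
  congr 1
  ext h
  obtain ⟨h, rfl⟩ := c.surjective h
  exact (coeff_mapDomainRingHom (f := (c : H →* H)) c.injective b h).trans (hb h).symm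

end Conjugation

/-! ### The Külshammer–Puig class: existence, uniqueness, Frobenius -/

section KuelshammerPuig

variable {R : Type v} {k : Type u} {G : Type u} [CommRing R] [Field k] [Group G]
  {red : R →+* k} {P : Subgroup G} {e : MonoidAlgebra R (Subgroup.centralizer (P : Set G))}

theorem coeff_reducedBlock (h : pc P) :
    (reducedBlock red e).coeff h = red ((incl R _ e).coeff h) := by
  have h1 : incl R (pc P)
      (MonoidAlgebra.mapDomainRingHom R (Subgroup.inclusion (centralizer_le_pc P)) e) =
      incl R _ e :=
    (RingHom.congr_fun (MonoidAlgebra.mapDomainRingHom_comp (R := R) (pc P).subtype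
      (Subgroup.inclusion (centralizer_le_pc P))) e).symm
  rw [← h1, coeff_incl, reducedBlock, ← reduce_mapDomainRingHom, coeff_reduce]

theorem pc_le_pairStabilizer
    (he : e ∈ Subring.center (MonoidAlgebra R (Subgroup.centralizer (P : Set G)))) :
    pc P ≤ pairStabilizer P e := by
  refine sup_le (fun g hg => ⟨Subgroup.le_normalizer hg, ?_⟩)
    (fun g hg => ⟨Subgroup.centralizer_le_normalizer _ hg, ?_⟩)
  · rw [fixedBy_iff_coeff]
    exact coeff_conj_eq_of_support_le_centralizer (fun h hh => coeff_incl_of_notMem e hh) hg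
  · rw [fixedBy_iff_coeff]
    intro h
    by_cases hh : h ∈ Subgroup.centralizer (P : Set G)
    · have := mem_center_iff_coeff.1 he ⟨g, hg⟩⁻¹ ⟨h, hh⟩
      rw [← coeff_incl, ← coeff_incl] at this
      simpa using this
    · rw [coeff_incl_of_notMem e hh, coeff_incl_of_notMem e]
      intro h'
      refine hh ?_
      have := mul_mem (mul_mem hg h') (inv_mem hg)
      simpa [mul_assoc] using this

theorem isKuelshammerPuigClass_iff {I : Subgroup G} [((pc P).subgroupOf I).Normal]
    (hpc : pc P ≤ I) (κ : H2Units (I ⧸ (pc P).subgroupOf I) k) :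
    IsKuelshammerPuigClass red P e I κ ↔
      ∃ (n : ℕ) (Y : Representation k (pc P) (Fin n → k))
        (X : I → LinearMap.GeneralLinearGroup k (Fin n → k))
        (α : groupCohomology.cocycles₂ (unitsRep (I ⧸ (pc P).subgroupOf I) k)),
        Y.IsIrreducible ∧ Y.asAlgebraHom (reducedBlock red e) = 1 ∧
        IsProjectiveExtension (Subgroup.inclusion hpc) ((pc P).subgroupOf I) Y X α ∧
        groupCohomology.H2π _ α = κ := by
  constructor
  · rintro ⟨n, Y, X, α, h1, h2, h3, h4, h5, h6⟩
    exact ⟨n, Y, X, α, h1, h2, ⟨fun h => h3 _ h.2, fun h x => (h4 _ x h.2).1,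
      fun h x => (h4 _ x h.2).2, h5⟩, h6⟩
  · rintro ⟨n, Y, X, α, h1, h2, h3, h4⟩
    exact ⟨n, Y, X, α, h1, h2, fun h hh => h3.apply_eq ⟨h, hh⟩,
      fun h x hh => ⟨h3.map_left ⟨h, hh⟩ x, h3.map_right ⟨h, hh⟩ x⟩, h3.mul_eq_smul, h4⟩

variable {p : ℕ} [Fact p.Prime] [CharP k p] [Finite G]

theorem IsSelfCentralizing.nonempty_equiv (hred : IsCompleteReduction red)
    (he : IsSelfCentralizing p red P e) {V W : Type*} [AddCommGroup V] [Module k V]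
    [AddCommGroup W] [Module k W] [FiniteDimensional k V] [FiniteDimensional k W]
    {ρ : Representation k (pc P) V} {σ : Representation k (pc P) W}
    [ρ.IsIrreducible] [σ.IsIrreducible] (hρ : ρ.asAlgebraHom (reducedBlock red e) = 1)
    (hσ : σ.asAlgebraHom (reducedBlock red e) = 1) : Nonempty (ρ.Equiv σ) :=
  nonempty_equiv_of_isBlockIdempotent (P := P.subgroupOf (pc P))
    (he.1.1.of_equiv (Subgroup.subgroupOfEquivOfLe (le_sup_left : P ≤ pc P)).symm)
    (exists_mul_eq_pc P) (he.isBlockIdempotent hred)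
    (fun _ hh => coeff_reducedBlock_of_notMem hh)
    (fun _ hQ hPQ _ hh => he.coeff_reducedBlock_eq_zero hred hQ hPQ hh) hρ hσ

/-- Since `I` stabilizes `e`, each conjugate of `Y` lies in the same block and so is isomorphic to
`Y`; the isomorphisms are the intertwiners needed to extend `Y`. The group `I` is kept variable so
that the class at `σ(e)` lives over the same quotient as the class at `e`. -/
theorem IsSelfCentralizing.existsUnique_isKuelshammerPuigClass [IsAlgClosed k]
    (hred : IsCompleteReduction red) (he : IsSelfCentralizing p red P e) {I : Subgroup G}
    [((pc P).subgroupOf I).Normal] (hpc : pc P ≤ I) (hI : I ≤ pairStabilizer P e) :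
    ∃! κ, IsKuelshammerPuigClass red P e I κ := by
  have hj := Subgroup.inclusion_range hpc
  have hj' := Subgroup.inclusion_injective hpc
  have hb := he.isBlockIdempotent hred
  obtain ⟨n, Y, hYi, hYb⟩ := exists_irreducible_asAlgebraHom_eq_one hb.1 hb.2.1 hb.2.2.1
  obtain ⟨X, α, hX⟩ := exists_isProjectiveExtension (Y := Y) hj hj' (by
    intro x
    obtain ⟨c, hc⟩ := exists_mulEquiv_map_eq_conj hj hj' x
    have hi := isIrreducible_comp_mulEquiv Y c
    have hbc : ∀ h, (reducedBlock red e).coeff (c h) = (reducedBlock red e).coeff h := by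
      intro h
      have h1 : ((c h : pc P) : G) = x * h * (x : G)⁻¹ := congrArg Subtype.val (hc h)
      have h2 := fixedBy_iff_coeff.1 (hI x.2).2 (c h)
      rw [coeff_reducedBlock, coeff_reducedBlock, ← h2, h1]
      congr 2
      group
    obtain ⟨φ⟩ := he.nonempty_equiv hred (ρ := Y)
      (σ := (MonoidHom.comp Y (c : pc P →* pc P) : Representation k (pc P) (Fin n → k))) hYb
      ((asAlgebraHom_comp_mulEquiv Y c hbc).trans hYb)
    refine ⟨LinearMap.GeneralLinearGroup.ofLinearEquiv φ.toLinearEquiv, fun h h' hh => ?_⟩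
    obtain rfl : c h = h' := hj' ((hc h).trans hh.symm)
    refine LinearMap.ext fun v => ?_
    exact Representation.IntertwiningMap.isIntertwining _ _ φ.toIntertwiningMap h v)
  refine ⟨groupCohomology.H2π _ α,
    (isKuelshammerPuigClass_iff hpc _).2 ⟨n, Y, X, α, hYi, hYb, hX, rfl⟩, fun κ hκ => ?_⟩
  obtain ⟨n', Y', X', α', hYi', hYb', hX', rfl⟩ := (isKuelshammerPuigClass_iff hpc _).1 hκ
  obtain ⟨φ⟩ := he.nonempty_equiv hred hYb' hYb
  exact hX'.H2π_eq hj φ hX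

omit [Finite G] in
theorem IsKuelshammerPuigClass.frobenius [IsAlgClosed k] {I : Subgroup G}
    [((pc P).subgroupOf I).Normal] (hpc : pc P ≤ I)
    {e' : MonoidAlgebra R (Subgroup.centralizer (P : Set G))}
    (h : reduce red _ e' = reduce (frobenius k p) _ (reduce red _ e))
    {κ : H2Units (I ⧸ (pc P).subgroupOf I) k} (hκ : IsKuelshammerPuigClass red P e I κ) :
    IsKuelshammerPuigClass red P e' I (p • κ) := by
  obtain ⟨n, Y, X, α, hYi, hYb, hX, rfl⟩ := (isKuelshammerPuigClass_iff hpc _).1 hκ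
  have hb : reducedBlock red e' = reduce (_root_.frobenius k p) _ (reducedBlock red e) := by
    rw [reducedBlock, reducedBlock, h, reduce_mapDomainRingHom]
  refine (isKuelshammerPuigClass_iff hpc _).2 ⟨n, frobeniusTwist p Y, _, p • α,
    frobeniusTwist_isIrreducible Y, ?_, hX.frobenius, map_nsmul _ _ _⟩
  rw [hb, frobeniusTwist_asAlgebraHom, hYb, map_one]

end KuelshammerPuig

end BlockTheory

/-! ### The main theorem -/

theorem lemma3 (p : ℕ) [Fact p.Prime] {G : Type u} [Group G] [Finite G]
    {k : Type u} [Field k] [IsAlgClosed k] [CharP k p]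
    {R : Type v} [CommRing R] (red : R →+* k)
    (hR : Function.Bijective red ∨ IsModularSystem red (Nat.card G))
    (P : Subgroup G) (e : MonoidAlgebra R (Subgroup.centralizer (P : Set G)))
    (he : IsSelfCentralizing p red P e) :
    (∃! e', IsFrobeniusConjugate p red e e') ∧
    ∀ e', IsFrobeniusConjugate p red e e' →
      IsSelfCentralizing p red P e' ∧
      pairStabilizer P e' = pairStabilizer P e ∧
      (∃! κ, IsKuelshammerPuigClass red P e (pairStabilizer P e) κ) ∧
      (∃! κ', IsKuelshammerPuigClass red P e' (pairStabilizer P e) κ') ∧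
      ∀ κ κ' : H2Units (pairStabilizer P e ⧸ (pc P).subgroupOf (pairStabilizer P e)) k,
        IsKuelshammerPuigClass red P e (pairStabilizer P e) κ →
        IsKuelshammerPuigClass red P e' (pairStabilizer P e) κ' →
        κ' = p • κ := by
  have hred : IsCompleteReduction red :=
    hR.elim isCompleteReduction_of_bijective IsModularSystem.isCompleteReduction
  have hτ : ((frobeniusEquiv k p : k ≃+* k) : k →+* k) = frobenius k p := by
    ext x
    simp
  refine ⟨?_, fun e' he' => ?_⟩
  · have := hred.existsUnique_twist (frobeniusEquiv k p) he.1.2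
    rwa [hτ] at this
  · have hred' : reduce red _ e' =
        reduce ((frobeniusEquiv k p : k ≃+* k) : k →+* k) _ (reduce red _ e) := by
      rw [hτ]
      exact he'.2
    have hsc := he.twist hred (frobeniusEquiv k p) he'.1 hred'
    have hst := pairStabilizer_twist hred (frobeniusEquiv k p) he.1.2 he'.1 hred'
    have hpc := pc_le_pairStabilizer he.1.2.1
    have huniq := hsc.existsUnique_isKuelshammerPuigClass hred hpc hst.ge
    exact ⟨hsc, hst, he.existsUnique_isKuelshammerPuigClass hred hpc le_rfl, huniq,
      fun κ κ' hκ hκ' => huniq.unique hκ' (hκ.frobenius hpc he'.2)⟩
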